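/- **Theorem (Full soundness of MLL+MIX).** Let $\Phi$ be a basis of interpretation, let $\pi$ be a proof of MLL+MIX (multiplicative linear logic with units and mix, with cuts) of conclusion $\vdash\Gamma$, and let $e$ be an enumeration of the occurrences of variable names in the axiom rules of $\pi$ which localizes $\pi$, i.e. such that $\pi^e$ is a proof of locMLL, of conclusion $\vdash\Gamma^e$. Then $I_\Phi(\vdash\Gamma^e)$ is a conduct, the project $I_\Phi(\pi^e)$ is defined, it is successful, and it belongs to $I_\Phi(\vdash\Gamma^e)$. *Graphs.* A (directed weighted) graph $G=(V_G,E_G,s,t,\omega)$ has a finite vertex set $V_G$, a finite or countable edge set $E_G$, source and target maps $s,t:E_G\to V_G$ and weights $\omega:E_G\to\,]0,1]$; graphs are considered up to renaming of edges. $G\cup H$ has vertices $V_G\cup V_H$ and edges $E_G\uplus E_H$. A path is a non-empty finite sequence of consecutive edges, and its weight is the product of the weights of its edges; a cycle is a path ending where it begins; a $1$-cycle is a cycle that is not $\rho^k$ for a cycle $\rho$ and $k\ge 2$. A path in $G\cup H$ is alternating if consecutive edges come from different graphs; an alternating cycle must moreover have its last and first edges in different graphs. An alternating $1$-circuit is an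 alternating $1$-cycle up to cyclic permutation. Put $[\![G,H]\!]=\sum_{c}-\log(1-\omega(c))\in[0,\infty]$, summed over the alternating $1$-circuits $c$, with $-\log 0=\infty$. The reduction $G\mathbin{::}H$ has vertex set $V_G\,\triangle\, V_H$ and as edges the alternating paths with source and target in $V_G\,\triangle\,V_H$, with their sources, targets and weights. *Projects.* A project $\mathfrak a=(a,A)$ is a real $a\ge0$ and a graph $A$; its carrier is $V_A$. Put $\langle\mathfrak a,\mathfrak b\rangle=a+b+[\![A,B]\!]$. For projects of the same carrier, $\mathfrak a\perp\mathfrak b$ means $\langle\mathfrak a,\mathfrak b\rangle\notin\{0,\infty\}$. For disjoint carriers, $\mathfrak a\otimes\mathfrak b=(\langle\mathfrak a,\mathfrak b\rangle,A\cup B)$. The cut $\mathfrak a\mathbin{::}\mathfrak b=(\langle\mathfrak a,\mathfrak b\rangle,A\mathbin{::}B)$ is defined when $\langle\mathfrak a,\mathfrak b\rangle\neq\infty$. Let $\widehat A$ be the simple graph with weights in $]0,\infty]$ obtained from $A$ by merging all edges with the same source and target and adding up their weights. The project $\mathfrak a$ is successful if $a=0$, $\widehat A$ is symmetric (for all $v,w$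 there is a weight-preserving bijection between the edges $v\to w$ and the edges $w\to v$), the graph of paths of length $3$ of $\widehat A$ equals $\widehat A$, and the sum of the weights of the loops of $A$ is $0$. For a finite set $V$ and an injection $\varphi$ on $V$ with $V\cap\varphi(V)=\emptyset$, $\mathfrak{Fax}_\varphi$ has wager $0$ and the graph on $V\cup\varphi(V)$ with edges $(v,\varphi(v))$ and $(\varphi(v),v)$, $v\in V$, all of weight $1$. *Conducts.* For a set $S$ of projects of carrier $X$, $S^\perp$ is the set of the projects of carrier $X$ orthogonal to all elements of $S$; a conduct is a non-empty $S$ with $S=S^{\perp\perp}$. For conducts of disjoint carriers, $\mathbf A\otimes\mathbf B=\{\mathfrak a\otimes\mathfrak b\mid\mathfrak a\in\mathbf A,\mathfrak b\in\mathbf B\}^{\perp\perp}$; $\mathbf A\multimap\mathbf B$ is the set of the $\mathfrak f$ of carrier the union of the two carriers such that, for all $\mathfrak a\in\mathbf A$, $\mathfrak f\mathbin{::}\mathfrak a$ is defined and lies in $\mathbf B$; $\mathbf A\parr\mathbf B=\mathbf A^\perp\multimap\mathbf B$. With $(0,\emptyset)$ the project with the empty graph on no vertices, $\mathbf 1=\{(0,\emptyset)\}^{\perp\perp}$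 and $\bot=\mathbf 1^\perp$. *Proofs.* Formulas of MLL+MIX are $X_i\mid X_i^\perp\mid F\otimes F\mid F\parr F\mid\mathbf 1\mid\bot$ ($i\in\mathbb N$), with negation given by De Morgan's identities. The rules (sequents up to exchange) are: axiom $\vdash X_i^\perp,X_i$; cut, from $\vdash A,\Delta$ and $\vdash A^\perp,\Gamma$ to $\vdash\Delta,\Gamma$; $\otimes$, from $\vdash A,\Delta$ and $\vdash B,\Gamma$ to $\vdash A\otimes B,\Delta,\Gamma$; $\parr$, from $\vdash A,B,\Gamma$ to $\vdash A\parr B,\Gamma$; $\vdash\mathbf 1$; $\bot$, from $\vdash\Gamma$ to $\vdash\bot,\Gamma$; mix, from $\vdash\Gamma$ and $\vdash\Delta$ to $\vdash\Gamma,\Delta$. Each name $X_i$ has a size $n_i\in\mathbb N$. In locMLL, variables are localized variables $X_i(j)$, $j\in\mathbb N$, of location $\{(i,m)\mid jn_i\le m<(j+1)n_i\}$; the location of a formula or sequent is the union of those of its variables. The rules are the same, with axioms $\vdash X_i(j)^\perp,X_i(j')$ for $j\ne j'$, and with the side conditions that $\Delta,\Gamma$ have disjoint locations (cut, mix), resp.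 that $A,\Delta$ and $B,\Gamma$ have disjoint locations ($\otimes$); moreover each $X_i(j)$, and each $X_i(j)^\perp$, appears in at most one axiom rule. $\pi^e$ is obtained from $\pi$ by replacing each occurrence of $X_i$ in an axiom by $X_i(j)$, where $j$ is the number given by $e$, and spreading this to the whole derivation; $\Gamma^e$ is its conclusion. *Interpretation.* A basis of interpretation $\Phi$ maps each $X_i$ to a conduct of carrier $\{0,\dots,n_i-1\}$. $I_\Phi(X_i(j))$ is $\Phi(X_i)$ transported along $x\mapsto(i,jn_i+x)$, $I_\Phi(X_i(j)^\perp)=I_\Phi(X_i(j))^\perp$, and $I_\Phi$ commutes with $\otimes,\parr,\mathbf 1,\bot$; $I_\Phi(\vdash\Gamma)$ is the $\parr$ of the interpretations of the formulas of $\Gamma$ ($\bot$ if $\Gamma$ is empty). The axiom $\vdash X_i(j)^\perp,X_i(j')$ is interpreted by $\mathfrak{Fax}$ of $(i,jn_i+x)\mapsto(i,j'n_i+x)$, $0\le x<n_i$; the rule $\mathbf 1$ by $(0,\emptyset)$; the rules $\otimes$ and mix by the tensor product of the interpretations of the premises; the cut rule by their cut; the rules $\parr$, $\bot$ and exchange do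 not change the interpretation. -/

import Mathlib

open scoped NNReal ENNReal

noncomputable section

namespace GoI

/-! ### Directed weighted graphs -/

/-- A directed graph with a finite set `V` of vertices (located in `α`), a finite or countably
infinite set `E` of edges, and weights in `]0, ∞]`. The graphs carried by projects have weights in
`]0, 1]`; larger weights only occur in the simple graph `G.hat` associated with a graph `G`. -/
structure WGraph (α : Type) where
  V : Finset α
  E : Type
  countable_edges : Countable E
  src : E → α
  tgt : E → α
  src_mem : ∀ e, src e ∈ V
  tgt_mem : ∀ e, tgt e ∈ V
  w : E → ℝ≥0∞
  w_pos : ∀ e, 0 < w e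

namespace WGraph

variable {α β : Type}

/-- The set of edges from `v` to `u`. -/
def Edges (G : WGraph α) (v u : α) : Type := {e : G.E // G.src e = v ∧ G.tgt e = u}

/-- Equality of graphs up to a renaming of the edges: same vertices, and a bijection between the
edges that preserves sources, targets and weights. -/
def Same (G H : WGraph α) : Prop :=
  G.V = H.V ∧ ∃ φ : G.E ≃ H.E,
    ∀ e, H.src (φ e) = G.src e ∧ H.tgt (φ e) = G.tgt e ∧ H.w (φ e) = G.w e

/-- For all vertices `v`, `u` there is a weight-preserving bijection between the edges from `v` to
`u` and the edges from `u` to `v`. -/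
def IsSymmetric (G : WGraph α) : Prop :=
  ∀ v ∈ G.V, ∀ u ∈ G.V, ∃ φ : G.Edges v u ≃ G.Edges u v, ∀ e, G.w (φ e).1 = G.w e.1

/-- The trace: the sum of the weights of all loops. -/
def trace (G : WGraph α) : ℝ≥0∞ := ∑ v ∈ G.V, ∑' e : G.Edges v v, G.w e.1

/-- A path: a non-empty finite sequence of consecutive edges. -/
def IsPath (G : WGraph α) (l : List G.E) : Prop :=
  l ≠ [] ∧ l.IsChain (fun e f => G.tgt e = G.src f)

/-- A cycle: a path that ends where it begins. -/
def IsCycle (G : WGraph α) (l : List G.E) : Prop :=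
  G.IsPath l ∧ ∃ h : l ≠ [], G.tgt (l.getLast h) = G.src (l.head h)

/-- `l` is a `k`-cycle: a cycle such that `k` is the greatest integer for which `l = ρ ^ k` for
some cycle `ρ`. -/
def IsKCycle (G : WGraph α) (k : ℕ) (l : List G.E) : Prop :=
  G.IsCycle l ∧ IsGreatest {m : ℕ | ∃ ρ, G.IsCycle ρ ∧ l = (List.replicate m ρ).flatten} k

/-- The weight of a path is the product of the weights of its edges. -/
def pathWeight (G : WGraph α) (l : List G.E) : ℝ≥0∞ := (l.map G.w).prod

lemma pathWeight_pos (G : WGraph α) (l : List G.E) : 0 < G.pathWeight l := by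
  unfold pathWeight
  induction l with
  | nil => simp
  | cons e l ih =>
    rw [List.map_cons, List.prod_cons]
    exact ENNReal.mul_pos (G.w_pos e).ne' ih.ne'

lemma pathWeight_le_one (G : WGraph α) (h : ∀ e, G.w e ≤ 1) (l : List G.E) :
    G.pathWeight l ≤ 1 := by
  unfold pathWeight
  induction l with
  | nil => simp
  | cons e l ih =>
    rw [List.map_cons, List.prod_cons]
    exact mul_le_one' (h e) ih

/-- The graph of paths of length `k` in `G` (for `k ≥ 1`). -/
def pow (G : WGraph α) (k : ℕ) : WGraph α where
  V := G.V
  E := {l : List G.E // G.IsPath l ∧ l.length = k}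
  countable_edges := by
    have := G.countable_edges
    infer_instance
  src l := G.src (l.1.head l.2.1.1)
  tgt l := G.tgt (l.1.getLast l.2.1.1)
  src_mem _ := G.src_mem _
  tgt_mem _ := G.tgt_mem _
  w l := G.pathWeight l.1
  w_pos l := G.pathWeight_pos l.1

/-- The simple graph obtained from `G` by merging all the edges with the same source and target
and adding up their weights. -/
def hat (G : WGraph α) : WGraph α where
  V := G.V
  E := {p : α × α // ∃ e, G.src e = p.1 ∧ G.tgt e = p.2}
  countable_edges := by
    have := G.countable_edges
    refine Function.Surjective.countable
      (f := fun e : G.E => (⟨(G.src e, G.tgt e), e, rfl, rfl⟩ :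
        {p : α × α // ∃ e, G.src e = p.1 ∧ G.tgt e = p.2})) ?_
    rintro ⟨p, e, h1, h2⟩
    exact ⟨e, Subtype.ext (Prod.ext h1 h2)⟩
  src p := p.1.1
  tgt p := p.1.2
  src_mem := by rintro ⟨p, e, h, -⟩; exact h ▸ G.src_mem e
  tgt_mem := by rintro ⟨p, e, -, h⟩; exact h ▸ G.tgt_mem e
  w p := ∑' e : G.Edges p.1.1 p.1.2, G.w e.1
  w_pos := by
    rintro ⟨p, e, h⟩
    exact lt_of_lt_of_le (G.w_pos e)
      (ENNReal.le_tsum (f := fun e : G.Edges p.1 p.2 => G.w e.1) ⟨e, h⟩)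

/-- The same graph, on the set of vertices `φ(V)`. -/
def deloc (φ : α ↪ β) (G : WGraph α) : WGraph β where
  V := G.V.map φ
  E := G.E
  countable_edges := G.countable_edges
  src e := φ (G.src e)
  tgt e := φ (G.tgt e)
  src_mem e := Finset.mem_map_of_mem φ (G.src_mem e)
  tgt_mem e := Finset.mem_map_of_mem φ (G.tgt_mem e)
  w := G.w
  w_pos := G.w_pos

/-- The graph without edges on a given set of vertices. -/
def edgeless (V : Finset α) : WGraph α where
  V := V
  E := Empty
  countable_edges := inferInstance
  src := Empty.elim
  tgt := Empty.elim
  src_mem e := e.elim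
  tgt_mem e := e.elim
  w := Empty.elim
  w_pos e := e.elim

variable [DecidableEq α]

/-- The union of two graphs: union of the sets of vertices, disjoint union of the sets of edges. -/
def union (G H : WGraph α) : WGraph α where
  V := G.V ∪ H.V
  E := G.E ⊕ H.E
  countable_edges := by
    have := G.countable_edges
    have := H.countable_edges
    infer_instance
  src := Sum.elim G.src H.src
  tgt := Sum.elim G.tgt H.tgt
  src_mem := by
    rintro (e | e)
    · exact Finset.mem_union_left _ (G.src_mem e)
    · exact Finset.mem_union_right _ (H.src_mem e)
  tgt_mem := by
    rintro (e | e)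
    · exact Finset.mem_union_left _ (G.tgt_mem e)
    · exact Finset.mem_union_right _ (H.tgt_mem e)
  w := Sum.elim G.w H.w
  w_pos := by
    rintro (e | e)
    · exact G.w_pos e
    · exact H.w_pos e

/-- The colouring of the edges of the plugging of `G` and `H`: `0` on the edges of `G` and `1` on
the edges of `H`. -/
def color (G H : WGraph α) : (G.union H).E → Fin 2 := Sum.elim (fun _ => 0) (fun _ => 1)

/-- Alternating paths between `G` and `H`: paths in the union graph in which the colours of
consecutive edges differ. -/
def IsAltPath (G H : WGraph α) (l : List (G.union H).E) : Prop :=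
  (G.union H).IsPath l ∧ l.IsChain (fun e f => color G H e ≠ color G H f)

/-- Alternating `1`-cycles: alternating paths that are `1`-cycles and whose last and first edges
have different colours. -/
def IsAltOneCycle (G H : WGraph α) (l : List (G.union H).E) : Prop :=
  IsAltPath G H l ∧ (G.union H).IsKCycle 1 l ∧
    ∃ h : l ≠ [], color G H (l.getLast h) ≠ color G H (l.head h)

/-- The set of alternating `1`-circuits between `G` and `H`: alternating `1`-cycles modulo cyclic
permutations. -/
def Circuits (G H : WGraph α) : Type :=
  {c : Cycle (G.union H).E // ∃ l : List (G.union H).E, (l : Cycle (G.union H).E) = c ∧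
    IsAltOneCycle G H l}

/-- The weight of a circuit: the product of the weights of its edges. -/
def circuitWeight (G H : WGraph α) (c : Circuits G H) : ℝ≥0∞ :=
  (c.1.toMultiset.map (G.union H).w).prod

/-- `x ↦ - log (1 - x)` for `x ∈ [0, 1]`, with value `∞` at `x = 1`. -/
def colog (x : ℝ≥0∞) : ℝ≥0∞ := if x < 1 then ENNReal.ofReal (-Real.log (1 - x.toReal)) else ⊤

/-- The interaction of two graphs (with weights in `]0, 1]`): the sum of `- log (1 - ω(c))` over
all alternating `1`-circuits `c`. -/
def interaction (G H : WGraph α) : ℝ≥0∞ := ∑' c : Circuits G H, colog (circuitWeight G H c)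

/-- The reduction of `G` and `H`: its vertices form the symmetric difference of the two sets of
vertices, and its edges are the alternating paths with both ends in this symmetric difference. -/
def reduction (G H : WGraph α) : WGraph α where
  V := symmDiff G.V H.V
  E := {l : List (G.union H).E // IsAltPath G H l ∧ ∃ h : l ≠ [],
    (G.union H).src (l.head h) ∈ symmDiff G.V H.V ∧
    (G.union H).tgt (l.getLast h) ∈ symmDiff G.V H.V}
  countable_edges := by
    have := (G.union H).countable_edges
    infer_instance
  src l := (G.union H).src (l.1.head l.2.1.1.1)
  tgt l := (G.union H).tgt (l.1.getLast l.2.1.1.1)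
  src_mem := by rintro ⟨l, hl, h, h1, h2⟩; exact h1
  tgt_mem := by rintro ⟨l, hl, h, h1, h2⟩; exact h2
  w l := (G.union H).pathWeight l.1
  w_pos l := (G.union H).pathWeight_pos l.1

lemma union_w_le_one {G H : WGraph α} (hG : ∀ e, G.w e ≤ 1) (hH : ∀ e, H.w e ≤ 1) :
    ∀ e, (G.union H).w e ≤ 1 := by
  rintro (e | e)
  · exact hG e
  · exact hH e

/-- The graph of axiom links: one edge `v → φ v` and one edge `φ v → v` for every `v` in `V`, all
of weight `1`. It is used when `φ` is injective on `V` and `V` is disjoint from `φ(V)`. -/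
def axiomLinks (V : Finset α) (φ : α → α) : WGraph α where
  V := V ∪ V.image φ
  E := {p : α × α // (p.1 ∈ V ∧ p.2 = φ p.1) ∨ (p.2 ∈ V ∧ p.1 = φ p.2)}
  countable_edges := by
    refine Set.Countable.to_subtype (s := {p : α × α |
      (p.1 ∈ V ∧ p.2 = φ p.1) ∨ (p.2 ∈ V ∧ p.1 = φ p.2)}) (Set.Countable.mono ?_
        ((V ∪ V.image φ) ×ˢ (V ∪ V.image φ)).countable_toSet)
    rintro ⟨a, b⟩ (⟨h, h'⟩ | ⟨h, h'⟩)
    all_goals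
      have := Finset.mem_image_of_mem φ h
      simp only [Finset.coe_product, Set.mem_prod, Finset.mem_coe, Finset.mem_union]
      simp_all
  src p := p.1.1
  tgt p := p.1.2
  src_mem := by
    rintro ⟨p, ⟨h, -⟩ | ⟨h, h'⟩⟩
    · exact Finset.mem_union_left _ h
    · exact Finset.mem_union_right _ (Finset.mem_image.2 ⟨_, h, h'.symm⟩)
  tgt_mem := by
    rintro ⟨p, ⟨h, h'⟩ | ⟨h, -⟩⟩
    · exact Finset.mem_union_right _ (Finset.mem_image.2 ⟨_, h, h'.symm⟩)
    · exact Finset.mem_union_left _ h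
  w _ := 1
  w_pos _ := one_pos

end WGraph

/-! ### Projects -/

/-- A project: a wager in `[0, ∞[` and a directed weighted graph with weights in `]0, 1]`. -/
structure Project (α : Type) where
  wager : ℝ≥0
  graph : WGraph α
  w_le_one : ∀ e, graph.w e ≤ 1

namespace Project

variable {α β : Type}

/-- The carrier of a project: the set of vertices of its graph. -/
def carrier (a : Project α) : Finset α := a.graph.V

/-- A project is successful when its wager is `0`, the simple graph `Â` is symmetric and satisfies
`Â ^ 3 = Â`, and the trace of its graph `A` is `0`. -/
def IsSuccessful (a : Project α) : Prop :=
  a.wager = 0 ∧ a.graph.hat.IsSymmetric ∧ (a.graph.hat.pow 3).Same a.graph.hat ∧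
    a.graph.trace = 0

/-- The delocation of a project. -/
def deloc (φ : α ↪ β) (a : Project α) : Project β := ⟨a.wager, a.graph.deloc φ, a.w_le_one⟩

/-- The project with wager `0` and the empty graph on the empty set of vertices. -/
def zero : Project α := ⟨0, WGraph.edgeless ∅, fun e => e.elim⟩

variable [DecidableEq α]

/-- The measurement of the interaction of two projects. -/
def sca (a b : Project α) : ℝ≥0∞ := a.wager + b.wager + a.graph.interaction b.graph

/-- Orthogonality of two projects of the same carrier. -/
def Orthogonal (a b : Project α) : Prop := a.carrier = b.carrier ∧ sca a b ≠ 0 ∧ sca a b ≠ ⊤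

open Classical in
/-- The tensor product of projects, defined when the carriers are disjoint. (The measurement
`sca a b` is then finite: there is no alternating circuit.) -/
def tensor (a b : Project α) : Option (Project α) :=
  if Disjoint a.carrier b.carrier then
    some ⟨(sca a b).toNNReal, a.graph.union b.graph, WGraph.union_w_le_one a.w_le_one b.w_le_one⟩
  else none

open Classical in
/-- The cut of two projects, defined when the measurement of their interaction is finite. -/
def cut (a b : Project α) : Option (Project α) :=
  if sca a b ≠ ⊤ then
    some ⟨(sca a b).toNNReal, a.graph.reduction b.graph, fun l =>
      WGraph.pathWeight_le_one _ (WGraph.union_w_le_one a.w_le_one b.w_le_one) l.1⟩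
  else none

/-- The project `Fax` of a bijection `φ` from `V` onto a set disjoint from `V`. -/
def fax (V : Finset α) (φ : α → α) : Project α := ⟨0, WGraph.axiomLinks V φ, fun _ => le_rfl⟩

end Project

/-! ### Conducts -/

/-- A set of projects, together with a carrier. -/
structure ProjectSet (α : Type) where
  carrier : Finset α
  projects : Set (Project α)

namespace ProjectSet

variable {α β : Type}

/-- The delocation of a set of projects. -/
def deloc (φ : α ↪ β) (S : ProjectSet α) : ProjectSet β :=
  ⟨S.carrier.map φ, Project.deloc φ '' S.projects⟩

variable [DecidableEq α]

/-- The orthogonal of a set of projects. -/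
def orth (S : ProjectSet α) : ProjectSet α :=
  ⟨S.carrier, {b | b.carrier = S.carrier ∧ ∀ a ∈ S.projects, a.Orthogonal b}⟩

/-- A conduct: a non-empty set of projects of the same carrier, equal to its biorthogonal. -/
def IsConduct (S : ProjectSet α) : Prop :=
  S.projects.Nonempty ∧ (∀ a ∈ S.projects, a.carrier = S.carrier) ∧ S.orth.orth = S

/-- The tensor product: the biorthogonal of the set of all `a ⊗ b` with `a ∈ A`, `b ∈ B`. -/
def tensor (A B : ProjectSet α) : ProjectSet α :=
  (ProjectSet.mk (A.carrier ∪ B.carrier)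
    {p | ∃ a ∈ A.projects, ∃ b ∈ B.projects, p ∈ Project.tensor a b}).orth.orth

/-- Linear implication: the projects `f` such that, for all `a ∈ A`, the cut of `f` and `a` is
defined and belongs to `B`. -/
def lolli (A B : ProjectSet α) : ProjectSet α :=
  ⟨A.carrier ∪ B.carrier, {f | f.carrier = A.carrier ∪ B.carrier ∧
    ∀ a ∈ A.projects, ∃ p ∈ Project.cut f a, p ∈ B.projects}⟩

/-- `A ⅋ B = A^⊥ ⊸ B`. -/
def par (A B : ProjectSet α) : ProjectSet α := A.orth.lolli B

/-- The conduct `1`. -/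
def one : ProjectSet α := (ProjectSet.mk ∅ {Project.zero}).orth.orth

/-- The conduct `⊥`. -/
def bot : ProjectSet α := (one : ProjectSet α).orth

end ProjectSet

/-! ### Formulas and proofs of MLL+MIX -/

/-- Formulas of multiplicative linear logic with units, over a set of atoms. The formulas of
MLL+MIX have atoms in `ℕ`, where `i` is the variable name `X_i`. The formulas of locMLL have atoms
in `ℕ × ℕ`, where `(i, j)` is the localized variable `X_i(j)`. -/
inductive Formula (At : Type) : Type
  | pos (x : At) : Formula At
  | neg (x : At) : Formula At
  | one : Formula At
  | bot : Formula At
  | tensor (A B : Formula At) : Formula At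
  | par (A B : Formula At) : Formula At

/-- Linear negation, through De Morgan's identities. -/
def Formula.dual {At : Type} : Formula At → Formula At
  | .pos x => .neg x
  | .neg x => .pos x
  | .one => .bot
  | .bot => .one
  | .tensor A B => .par A.dual B.dual
  | .par A B => .tensor A.dual B.dual

/-- Proofs of MLL+MIX. Sequents are lists of formulas, with an explicit exchange rule. -/
inductive MLLProof : List (Formula ℕ) → Type
  | ax (i : ℕ) : MLLProof [.neg i, .pos i]
  | cut {A : Formula ℕ} {Δ Γ : List (Formula ℕ)} (p : MLLProof (A :: Δ))
      (q : MLLProof (A.dual :: Γ)) : MLLProof (Δ ++ Γ)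
  | tensor {A B : Formula ℕ} {Δ Γ : List (Formula ℕ)} (p : MLLProof (A :: Δ))
      (q : MLLProof (B :: Γ)) : MLLProof (.tensor A B :: (Δ ++ Γ))
  | par {A B : Formula ℕ} {Γ : List (Formula ℕ)} (p : MLLProof (A :: B :: Γ)) :
      MLLProof (.par A B :: Γ)
  | one : MLLProof [.one]
  | bot {Γ : List (Formula ℕ)} (p : MLLProof Γ) : MLLProof (.bot :: Γ)
  | mix {Γ Δ : List (Formula ℕ)} (p : MLLProof Γ) (q : MLLProof Δ) : MLLProof (Γ ++ Δ)
  | exchange {Γ Δ : List (Formula ℕ)} {A B : Formula ℕ} (p : MLLProof (Γ ++ A :: B :: Δ)) :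
      MLLProof (Γ ++ B :: A :: Δ)

/-- The two occurrences of a variable name in an axiom rule `⊢ X_i^⊥, X_i`. -/
inductive AxOcc : Type
  | neg : AxOcc
  | pos : AxOcc

/-- The occurrences of variable names in the axiom rules of a proof. -/
def Occ : {Γ : List (Formula ℕ)} → MLLProof Γ → Type
  | _, .ax _ => AxOcc
  | _, .cut p q => Occ p ⊕ Occ q
  | _, .tensor p q => Occ p ⊕ Occ q
  | _, .par p => Occ p
  | _, .one => Empty
  | _, .bot p => Occ p
  | _, .mix p q => Occ p ⊕ Occ q
  | _, .exchange p => Occ p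

/-! ### Localized formulas and proofs

`n i` is the size of the variable name `X_i`. -/

/-- The location of the localized variable `X_i(j)`: the pairs `(i, m)` with
`j * n i ≤ m < (j + 1) * n i`. -/
def varLocation (n : ℕ → ℕ) (x : ℕ × ℕ) : Finset (ℕ × ℕ) :=
  (Finset.Ico (x.2 * n x.1) ((x.2 + 1) * n x.1)).image (fun m => (x.1, m))

/-- The location of a localized formula. -/
def Formula.location (n : ℕ → ℕ) : Formula (ℕ × ℕ) → Finset (ℕ × ℕ)
  | .pos x => varLocation n x
  | .neg x => varLocation n x
  | .one => ∅
  | .bot => ∅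
  | .tensor A B => A.location n ∪ B.location n
  | .par A B => A.location n ∪ B.location n

/-- The location of a list of localized formulas. -/
def seqLocation (n : ℕ → ℕ) (Γ : List (Formula (ℕ × ℕ))) : Finset (ℕ × ℕ) :=
  Γ.foldr (fun A s => A.location n ∪ s) ∅

/-- Derivations of the localized sequent calculus. The side conditions ensure that in every
derivable sequent the formulas have pairwise disjoint locations, and that in every subformula
`A ⊗ B` or `A ⅋ B` the locations of `A` and `B` are disjoint. -/
inductive LocProof (n : ℕ → ℕ) : List (Formula (ℕ × ℕ)) → Type
  | ax (i j j' : ℕ) (h : j ≠ j') : LocProof n [.neg (i, j), .pos (i, j')]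
  | cut {A : Formula (ℕ × ℕ)} {Δ Γ : List (Formula (ℕ × ℕ))} (p : LocProof n (A :: Δ))
      (q : LocProof n (A.dual :: Γ)) (h : Disjoint (seqLocation n Δ) (seqLocation n Γ)) :
      LocProof n (Δ ++ Γ)
  | tensor {A B : Formula (ℕ × ℕ)} {Δ Γ : List (Formula (ℕ × ℕ))} (p : LocProof n (A :: Δ))
      (q : LocProof n (B :: Γ)) (h : Disjoint (A.location n ∪ seqLocation n Δ)
        (B.location n ∪ seqLocation n Γ)) : LocProof n (.tensor A B :: (Δ ++ Γ))
  | par {A B : Formula (ℕ × ℕ)} {Γ : List (Formula (ℕ × ℕ))} (p : LocProof n (A :: B :: Γ)) :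
      LocProof n (.par A B :: Γ)
  | one : LocProof n [.one]
  | bot {Γ : List (Formula (ℕ × ℕ))} (p : LocProof n Γ) : LocProof n (.bot :: Γ)
  | mix {Γ Δ : List (Formula (ℕ × ℕ))} (p : LocProof n Γ) (q : LocProof n Δ)
      (h : Disjoint (seqLocation n Γ) (seqLocation n Δ)) : LocProof n (Γ ++ Δ)
  | exchange {Γ Δ : List (Formula (ℕ × ℕ))} {A B : Formula (ℕ × ℕ)}
      (p : LocProof n (Γ ++ A :: B :: Δ)) : LocProof n (Γ ++ B :: A :: Δ)

/-- The list of the axiom rules of a localized derivation, where `((i, j), (i, j'))` stands for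
`⊢ X_i(j)^⊥, X_i(j')`. -/
def LocProof.axioms {n : ℕ → ℕ} : {Γ : List (Formula (ℕ × ℕ))} → LocProof n Γ →
    List ((ℕ × ℕ) × (ℕ × ℕ))
  | _, .ax i j j' _ => [((i, j), (i, j'))]
  | _, .cut p q _ => p.axioms ++ q.axioms
  | _, .tensor p q _ => p.axioms ++ q.axioms
  | _, .par p => p.axioms
  | _, .one => []
  | _, .bot p => p.axioms
  | _, .mix p q _ => p.axioms ++ q.axioms
  | _, .exchange p => p.axioms

/-- Every negation of a localized variable and every localized variable appears in at most one
axiom rule. The proofs of locMLL are the derivations with this property. -/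
def LocProof.IsLinear {n : ℕ → ℕ} {Γ : List (Formula (ℕ × ℕ))} (ρ : LocProof n Γ) : Prop :=
  (ρ.axioms.map Prod.fst).Nodup ∧ (ρ.axioms.map Prod.snd).Nodup

/-- `Localizes n π e ρ`: the localized derivation `ρ` is `π ^ e`, that is, it is obtained from `π`
by replacing every occurrence of a variable name `X_i` in an axiom rule by the localized variable
`X_i(j)`, where `j` is the number that `e` gives to this occurrence, and by spreading these
replacements to the whole derivation tree. -/
inductive Localizes (n : ℕ → ℕ) : {Γ : List (Formula ℕ)} → (π : MLLProof Γ) → (Occ π → ℕ) →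
    {Γ' : List (Formula (ℕ × ℕ))} → LocProof n Γ' → Prop
  | ax (i : ℕ) (e : Occ (.ax i) → ℕ) (h : e AxOcc.neg ≠ e AxOcc.pos) :
      Localizes n (.ax i) e (.ax i (e AxOcc.neg) (e AxOcc.pos) h)
  | cut {A : Formula ℕ} {Δ Γ : List (Formula ℕ)} {p : MLLProof (A :: Δ)}
      {q : MLLProof (A.dual :: Γ)} {e : Occ (.cut p q) → ℕ}
      {A' : Formula (ℕ × ℕ)} {Δ' Γ' : List (Formula (ℕ × ℕ))} {p' : LocProof n (A' :: Δ')}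
      {q' : LocProof n (A'.dual :: Γ')} (h : Disjoint (seqLocation n Δ') (seqLocation n Γ'))
      (hp : Localizes n p (fun o => e (Sum.inl o)) p')
      (hq : Localizes n q (fun o => e (Sum.inr o)) q') :
      Localizes n (.cut p q) e (.cut p' q' h)
  | tensor {A B : Formula ℕ} {Δ Γ : List (Formula ℕ)} {p : MLLProof (A :: Δ)}
      {q : MLLProof (B :: Γ)} {e : Occ (.tensor p q) → ℕ}
      {A' B' : Formula (ℕ × ℕ)} {Δ' Γ' : List (Formula (ℕ × ℕ))} {p' : LocProof n (A' :: Δ')}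
      {q' : LocProof n (B' :: Γ')} (h : Disjoint (A'.location n ∪ seqLocation n Δ')
        (B'.location n ∪ seqLocation n Γ'))
      (hp : Localizes n p (fun o => e (Sum.inl o)) p')
      (hq : Localizes n q (fun o => e (Sum.inr o)) q') :
      Localizes n (.tensor p q) e (.tensor p' q' h)
  | par {A B : Formula ℕ} {Γ : List (Formula ℕ)} {p : MLLProof (A :: B :: Γ)}
      {e : Occ (.par p) → ℕ} {A' B' : Formula (ℕ × ℕ)} {Γ' : List (Formula (ℕ × ℕ))}
      {p' : LocProof n (A' :: B' :: Γ')} (hp : Localizes n p e p') :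
      Localizes n (.par p) e (.par p')
  | one (e : Occ .one → ℕ) : Localizes n .one e .one
  | bot {Γ : List (Formula ℕ)} {p : MLLProof Γ} {e : Occ (.bot p) → ℕ}
      {Γ' : List (Formula (ℕ × ℕ))} {p' : LocProof n Γ'}
      (hp : Localizes n p e p') : Localizes n (.bot p) e (.bot p')
  | mix {Γ Δ : List (Formula ℕ)} {p : MLLProof Γ} {q : MLLProof Δ} {e : Occ (.mix p q) → ℕ}
      {Γ' Δ' : List (Formula (ℕ × ℕ))} {p' : LocProof n Γ'} {q' : LocProof n Δ'}
      (h : Disjoint (seqLocation n Γ') (seqLocation n Δ'))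
      (hp : Localizes n p (fun o => e (Sum.inl o)) p')
      (hq : Localizes n q (fun o => e (Sum.inr o)) q') :
      Localizes n (.mix p q) e (.mix p' q' h)
  | exchange {Γ Δ : List (Formula ℕ)} {A B : Formula ℕ} {p : MLLProof (Γ ++ A :: B :: Δ)}
      {e : Occ (.exchange p) → ℕ} {Γ' Δ' : List (Formula (ℕ × ℕ))} {A' B' : Formula (ℕ × ℕ)}
      {p' : LocProof n (Γ' ++ A' :: B' :: Δ')} (hlen : Γ'.length = Γ.length)
      (hp : Localizes n p e p') :
      Localizes n (.exchange p) e (.exchange p')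

/-! ### Interpretation -/

/-- A basis of interpretation associates to every variable name `X_i` a conduct of carrier
`{0, …, n i - 1}`. -/
def IsBasis (n : ℕ → ℕ) (Φ : ℕ → ProjectSet ℕ) : Prop :=
  ∀ i, (Φ i).IsConduct ∧ (Φ i).carrier = Finset.range (n i)

/-- The map `x ↦ (i, j * n i + x)`. -/
def varEmbedding (n : ℕ → ℕ) (x : ℕ × ℕ) : ℕ ↪ ℕ × ℕ :=
  ⟨fun k => (x.1, x.2 * n x.1 + k), fun _ _ h => by simpa using h⟩

/-- The interpretation of localized formulas. -/
def interpFormula (n : ℕ → ℕ) (Φ : ℕ → ProjectSet ℕ) : Formula (ℕ × ℕ) → ProjectSet (ℕ × ℕ)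
  | .pos x => (Φ x.1).deloc (varEmbedding n x)
  | .neg x => ((Φ x.1).deloc (varEmbedding n x)).orth
  | .one => ProjectSet.one
  | .bot => ProjectSet.bot
  | .tensor A B => (interpFormula n Φ A).tensor (interpFormula n Φ B)
  | .par A B => (interpFormula n Φ A).par (interpFormula n Φ B)

/-- The interpretation of a sequent: the `⅋` of its formulas (`⊥` for the empty sequent). -/
def interpSequent (n : ℕ → ℕ) (Φ : ℕ → ProjectSet ℕ) :
    List (Formula (ℕ × ℕ)) → ProjectSet (ℕ × ℕ)
  | [] => ProjectSet.bot
  | [A] => interpFormula n Φ A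
  | A :: B :: Γ => (interpFormula n Φ A).par (interpSequent n Φ (B :: Γ))

/-- The interpretation of localized proofs, which is undefined when a tensor product or a cut is.
An axiom rule `⊢ X_i(j)^⊥, X_i(j')` is interpreted by the `Fax` of the bijection
`(i, j * n i + x) ↦ (i, j' * n i + x)`, for `0 ≤ x < n i`. -/
def interpProof {n : ℕ → ℕ} : {Γ : List (Formula (ℕ × ℕ))} → LocProof n Γ →
    Option (Project (ℕ × ℕ))
  | _, .ax i j j' _ => some (Project.fax (varLocation n (i, j))
      (fun v => (v.1, j' * n i + (v.2 - j * n i))))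
  | _, .cut p q _ => (interpProof p).bind fun a => (interpProof q).bind fun b => Project.cut a b
  | _, .tensor p q _ =>
      (interpProof p).bind fun a => (interpProof q).bind fun b => Project.tensor a b
  | _, .par p => interpProof p
  | _, .one => some Project.zero
  | _, .bot p => interpProof p
  | _, .mix p q _ =>
      (interpProof p).bind fun a => (interpProof q).bind fun b => Project.tensor a b
  | _, .exchange p => interpProof p

end GoI

end

noncomputable section

namespace GoI

/-! ### Primitive cyclic words -/

section Words

variable {E F : Type}

/-! The proof has a combinatorial half and a logical half.

Combinatorially, alternating `1`-circuits are the primitive cyclic words in edges whose consecutive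
letters are related (`circ`), and an interaction is a sum over them (`circSum`). A cyclic word on
two alphabets that meets the left one can be cut before each of its left letters. This gives a
cyclic word of blocks, bijectively and without changing primitivity or weight (`circSum_sum`). If
the right letters are the edges of `G` and `H` and the left ones those of a third graph that avoids
the common vertices of `G` and `H`, the runs of right letters are exactly the edges of the reduction
(`plugSum_reduction`). Expanding reductions in this way and matching the circuits gives the
three-term adjunction `interaction_union_right` and its variants for the cut and tensor rules.

Logically, the adjunction turns a linear implication into the orthogonal of a set of juxtapositions
(`lolli_orth`). Hence the interpretation of a sequent is the orthogonal of its `tests`, which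
juxtapose one counter-project per formula (`interpSequent_eq`), and is a conduct. Each rule is
checked against tests. A premise cut with a test of its context lands in the conduct of its active
formula (`exec_mem`), and the interaction identities transfer orthogonality to the conclusion. An
axiom holds because plugging axiom links into a graph only moves it to the other location
(`interaction_axiomLinks`).

Success follows from a stronger invariant: the wager is `0` and the graph is a partial matching with
weights `1` (`WGraph.IsMatching`). Unions of disjoint matchings and reductions of matchings are
matchings. The interaction of two matchings is `0` or `∞`; soundness of the cut excludes `∞`, so no
wager is ever created. `LocProof.sound` carries both halves through one induction on the derivation.
-/

/-- A word is primitive when it is not a proper power. -/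
def IsPrimitive (l : List E) : Prop :=
  ∀ (ρ : List E) (m : ℕ), l = (List.replicate m ρ).flatten → m ≤ 1

/-- The empty word is its own square. This keeps the empty cycle out of `circ`. -/
lemma IsPrimitive.ne_nil {l : List E} (h : IsPrimitive l) : l ≠ [] := by
  rintro rfl
  have := h [] 2 (by simp)
  omega

/-- Moves a power along a rotation by one letter, as `IsPrimitive.rotate` requires. -/
lemma flatten_replicate_cons_append (a : E) (s : List E) (m : ℕ) :
    (List.replicate m (a :: s)).flatten ++ [a] = a :: (List.replicate m (s ++ [a])).flatten := by
  induction m with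
  | zero => simp
  | succ m ih => simp [List.replicate_succ, ih]

lemma IsPrimitive.rotate {l : List E} (h : IsPrimitive l) (k : ℕ) : IsPrimitive (l.rotate k) := by
  induction k with
  | zero => simpa using h
  | succ k ih =>
    rw [← List.rotate_rotate]
    intro ρ m hm
    generalize l.rotate k = l' at *
    rcases List.eq_nil_or_concat ρ with rfl | ⟨s, a, rfl⟩
    · have : l' = [] := by simpa [List.rotate_eq_nil_iff] using hm
      exact absurd this ih.ne_nil
    · cases l' with
      | nil => exact absurd rfl ih.ne_nil
      | cons b t =>
        rcases m with _ | m
        · omega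
        refine ih (a :: s) (m + 1) ?_
        have h1 : t ++ [b] = (List.replicate (m + 1) (s ++ [a])).flatten := by
          simpa using hm
        have h2 := flatten_replicate_cons_append a s (m + 1)
        rw [← h1] at h2
        have h3 : (List.replicate (m + 1) (a :: s)).flatten ++ [a] = (a :: t) ++ [b] := by
          simpa using h2
        obtain ⟨h4, h5⟩ := List.append_inj' h3 rfl
        rw [h4]
        simpa using h5.symm

lemma IsPrimitive.of_isRotated {l l' : List E} (h : IsPrimitive l) (hl : l ~r l') :
    IsPrimitive l' := by
  obtain ⟨k, rfl⟩ := hl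
  exact h.rotate k

/-- A cyclic word is primitive when it is not a proper power. -/
def IsPrimitiveCycle (c : Cycle E) : Prop := ∀ l : List E, (l : Cycle E) = c → IsPrimitive l

lemma isPrimitiveCycle_coe (l : List E) : IsPrimitiveCycle (l : Cycle E) ↔ IsPrimitive l :=
  ⟨fun h => h l rfl, fun h _ hl => h.of_isRotated (Cycle.coe_eq_coe.1 hl).symm⟩

/-- A root with positive exponent uses only letters of the word itself, so a root of the image word
lifts through `f`. -/
lemma isPrimitive_map {f : E → F} (hf : Function.Injective f) (l : List E) :
    IsPrimitive (l.map f) ↔ IsPrimitive l := by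
  constructor
  · rintro h ρ m rfl
    exact h (ρ.map f) m (by simp [List.map_flatten])
  · intro h ρ m hm
    by_contra hm1
    have hρ : ρ ∈ Set.range (List.map f) := by
      rw [Set.range_list_map]
      intro x hx
      have : x ∈ l.map f := by
        rw [hm, List.mem_flatten]
        exact ⟨ρ, List.mem_replicate.2 ⟨by omega, rfl⟩, hx⟩
      obtain ⟨y, -, rfl⟩ := List.mem_map.1 this
      exact ⟨y, rfl⟩
    obtain ⟨ρ, rfl⟩ := hρ
    refine hm1 (h ρ m (List.map_injective_iff.2 hf ?_))
    simpa [List.map_flatten] using hm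

lemma cycle_map_injective {f : E → F} (hf : Function.Injective f) :
    Function.Injective (Cycle.map f) := by
  intro c c'
  induction c using Quotient.inductionOn'
  induction c' using Quotient.inductionOn'
  rename_i l l'
  intro h
  obtain ⟨k, hk⟩ := Cycle.coe_eq_coe.1 (h : ((l.map f : List F) : Cycle F) = (l'.map f : List F))
  refine Cycle.coe_eq_coe.2 ⟨k, List.map_injective_iff.2 hf ?_⟩
  rwa [List.map_rotate]

/-- Rotate the cycle so that it begins with `e`: its last letter is a predecessor of `e` and its
second one a successor, both being `e` itself in a one-letter cycle. Letters without neighbours on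
both sides can thus be discarded. -/
lemma exists_of_mem_chain {R : E → E → Prop} {c : Cycle E} (hc : c.Chain R) {e : E} (he : e ∈ c) :
    (∃ a, R a e) ∧ ∃ b, R e b := by
  induction c using Quotient.inductionOn'
  rename_i l
  obtain ⟨s, t, rfl⟩ := List.append_of_mem (show e ∈ l from he)
  have h : Cycle.Chain R ((e :: (t ++ s) : List E) : Cycle E) := by
    have hr : ((e :: (t ++ s) : List E) : Cycle E) = ((s ++ e :: t : List E) : Cycle E) :=
      Cycle.coe_eq_coe.2 (List.isRotated_append (l := e :: t) (l' := s))
    rwa [hr]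
  refine ⟨?_, ?_⟩
  · rw [Cycle.chain_ne_nil R (List.cons_ne_nil _ _)] at h
    exact ⟨_, h.rel⟩
  · rw [Cycle.chain_coe_cons] at h
    cases hts : t ++ s with
    | nil => rw [hts] at h; exact ⟨_, h.rel⟩
    | cons b r => rw [hts] at h; exact ⟨_, h.rel⟩

/-- The circuits of a relation: the primitive cyclic words in which consecutive letters are
related. -/
def circ (R : E → E → Prop) : Set (Cycle E) := {c | c.Chain R ∧ IsPrimitiveCycle c}

/-- The sum of `- log (1 - w c)` over the circuits `c` of a relation. -/
def circSum (R : E → E → Prop) (w : E → ℝ≥0∞) : ℝ≥0∞ :=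
  ∑' c : circ R, WGraph.colog (c.1.toMultiset.map w).prod

lemma tsum_eq_of_bijOn {A B : Type} {s : Set A} {t : Set B} (φ : A → B) (h : Set.BijOn φ s t)
    (f : A → ℝ≥0∞) (g : B → ℝ≥0∞) (hfg : ∀ a ∈ s, g (φ a) = f a) :
    ∑' a : s, f a = ∑' b : t, g b := by
  rw [← (Set.BijOn.equiv φ h).tsum_eq]
  exact tsum_congr fun a => (hfg a a.2).symm

lemma toMultiset_map_map (f : E → F) (c : Cycle E) (w : F → ℝ≥0∞) :
    ((c.map f).toMultiset.map w).prod = (c.toMultiset.map (w ∘ f)).prod := by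
  induction c using Quotient.inductionOn'
  rename_i l
  change ((((l.map f : List F) : Cycle F)).toMultiset.map w).prod =
    ((((l : List E) : Cycle E)).toMultiset.map (w ∘ f)).prod
  simp

lemma map_mem_circ {f : E → F} (hf : Function.Injective f) {R : E → E → Prop}
    {S : F → F → Prop} (hR : ∀ a b, R a b ↔ S (f a) (f b)) (c : Cycle E) :
    c.map f ∈ circ S ↔ c ∈ circ R := by
  have h1 : R = fun a b => S (f a) (f b) := by ext a b; exact hR a b
  subst h1
  refine and_congr (Cycle.chain_map f) ?_
  induction c using Quotient.inductionOn'
  rename_i l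
  change IsPrimitiveCycle ((l.map f : List F) : Cycle F) ↔ IsPrimitiveCycle (l : Cycle E)
  rw [isPrimitiveCycle_coe, isPrimitiveCycle_coe, isPrimitive_map hf]

lemma exists_map_eq {f : E → F} {c : Cycle F} (h : ∀ e ∈ c, e ∈ Set.range f) :
    ∃ c' : Cycle E, c'.map f = c := by
  induction c using Quotient.inductionOn'
  rename_i l
  have : l ∈ Set.range (List.map f) := by
    rw [Set.range_list_map]
    exact h
  obtain ⟨l', rfl⟩ := this
  exact ⟨l', rfl⟩

/-- Circuits are preserved by an embedding whose range contains all the letters that have a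
predecessor and a successor. -/
lemma circSum_embed (f : E → F) (hf : Function.Injective f) {R : E → E → Prop}
    {S : F → F → Prop} {w : E → ℝ≥0∞} {v : F → ℝ≥0∞} (hR : ∀ a b, R a b ↔ S (f a) (f b))
    (hw : ∀ a, v (f a) = w a)
    (hr : ∀ e a b, S a e → S e b → e ∈ Set.range f) : circSum R w = circSum S v := by
  refine tsum_eq_of_bijOn (Cycle.map f) ⟨fun c hc => (map_mem_circ hf hR c).2 hc,
    (cycle_map_injective hf).injOn, fun c hc => ?_⟩
    (fun c => WGraph.colog (c.toMultiset.map w).prod)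
    (fun c => WGraph.colog (c.toMultiset.map v).prod) fun c _ => ?_
  · obtain ⟨c', rfl⟩ := exists_map_eq (f := f) (c := c) fun e he => by
      obtain ⟨⟨a, ha⟩, b, hb⟩ := exists_of_mem_chain hc.1 he
      exact hr e a b ha hb
    exact ⟨c', (map_mem_circ hf hR c').1 hc, rfl⟩
  · simp only [toMultiset_map_map]
    rw [show v ∘ f = w from funext hw]

lemma circSum_equiv (f : E ≃ F) {R : E → E → Prop} {S : F → F → Prop} {w : E → ℝ≥0∞}
    {v : F → ℝ≥0∞} (hR : ∀ a b, R a b ↔ S (f a) (f b)) (hw : ∀ a, v (f a) = w a) :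
    circSum R w = circSum S v :=
  circSum_embed f f.injective hR hw fun e _ _ _ _ => f.surjective e

/-- A letter on a circuit has a predecessor and a successor, so here the empty alphabet already
carries all circuits. -/
lemma circSum_eq_zero {R : E → E → Prop} {w : E → ℝ≥0∞}
    (h : ∀ a b c, R a b → R b c → False) : circSum R w = 0 := by
  refine (circSum_embed (Empty.elim : Empty → E) (fun e => e.elim) (R := fun _ _ => False)
    (w := fun _ => 0) (fun e => e.elim) (fun e => e.elim) fun e a b h1 h2 =>
      (h a e b h1 h2).elim).symm.trans ?_
  have : IsEmpty (circ (fun _ _ : Empty => False)) := by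
    refine ⟨fun c => ?_⟩
    obtain ⟨c, hc, hp⟩ := c
    induction c using Quotient.inductionOn'
    rename_i l
    cases l with
    | nil => exact (hp [] rfl).ne_nil rfl
    | cons a l => exact a.elim
  exact tsum_empty

/-! ### Blocks -/

/-- The word consisting of one letter on the left followed by letters on the right. -/
def block (b : E × List F) : List (E ⊕ F) := Sum.inl b.1 :: b.2.map Sum.inr

/-- The concatenation of a list of blocks. -/
def unblock (l : List (E × List F)) : List (E ⊕ F) := l.flatMap block

@[simp] lemma unblock_nil : unblock ([] : List (E × List F)) = [] := rfl

@[simp] lemma unblock_cons (b : E × List F) (l : List (E × List F)) :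
    unblock (b :: l) = Sum.inl b.1 :: (b.2.map Sum.inr ++ unblock l) := by
  simp [unblock, block]

@[simp] lemma unblock_append (l l' : List (E × List F)) :
    unblock (l ++ l') = unblock l ++ unblock l' := by
  simp [unblock]

lemma unblock_pow (m : ℕ) (l : List (E × List F)) :
    unblock (List.replicate m l).flatten = (List.replicate m (unblock l)).flatten := by
  induction m with
  | zero => simp
  | succ m ih => simp [List.replicate_succ, ih]

lemma exists_unblock (l : List (E ⊕ F)) : ∃ (m : List F) (bs : List (E × List F)),
    l = m.map Sum.inr ++ unblock bs := by
  induction l with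
  | nil => exact ⟨[], [], rfl⟩
  | cons e l ih =>
    obtain ⟨m, bs, rfl⟩ := ih
    rcases e with e | e
    · exact ⟨[], (e, m) :: bs, by simp⟩
    · exact ⟨e :: m, bs, by simp⟩

lemma exists_unblock_cons (e : E) (l : List (E ⊕ F)) :
    ∃ bs : List (E × List F), unblock bs = Sum.inl e :: l := by
  obtain ⟨m, bs, rfl⟩ := exists_unblock l
  exact ⟨(e, m) :: bs, by simp⟩

/-- A concatenation of blocks is empty or begins with a left letter, so the initial run of right
letters can be read off the word. -/
lemma map_inr_append_unblock_inj {m m' : List F} {l l' : List (E × List F)}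
    (h : m.map Sum.inr ++ unblock l = m'.map Sum.inr ++ unblock l') :
    m = m' ∧ unblock l = unblock l' := by
  induction m generalizing m' with
  | nil =>
    cases m' with
    | nil => exact ⟨rfl, by simpa using h⟩
    | cons a m' => cases l <;> simp at h
  | cons a m ih =>
    cases m' with
    | nil => cases l' <;> simp at h
    | cons a' m' =>
      simp only [List.map_cons, List.cons_append, List.cons.injEq, Sum.inr.injEq] at h
      obtain ⟨h1, h2⟩ := ih h.2
      exact ⟨by rw [h.1, h1], h2⟩

lemma unblock_injective : Function.Injective (unblock : List (E × List F) → List (E ⊕ F)) := by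
  intro l
  induction l with
  | nil =>
    intro l' h
    cases l' with
    | nil => rfl
    | cons b l' => simp at h
  | cons b l ih =>
    intro l' h
    cases l' with
    | nil => simp at h
    | cons b' l' =>
      simp only [unblock_cons, List.cons.injEq, Sum.inl.injEq] at h
      obtain ⟨h1, h2⟩ := map_inr_append_unblock_inj h.2
      rw [ih h2, Prod.ext h.1 h1]

lemma unblock_isRotated {l l' : List (E × List F)} (h : l ~r l') : unblock l ~r unblock l' := by
  obtain ⟨k, hk, rfl⟩ := List.isRotated_iff_mod.1 h
  rw [List.rotate_eq_drop_append_take hk, unblock_append]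
  nth_rw 1 [← List.take_append_drop k l]
  rw [unblock_append]
  exact List.isRotated_append

/-- The rotation has to cut at a block boundary. Each of the two pieces is a prefix of one of the
two words, so it is empty or begins with a left letter, and is itself a concatenation of blocks. -/
lemma isRotated_of_unblock {l l' : List (E × List F)} (h : unblock l ~r unblock l') : l ~r l' := by
  obtain ⟨k, hk, h⟩ := List.isRotated_iff_mod.1 h
  rw [List.rotate_eq_drop_append_take hk] at h
  have h0 := List.take_append_drop k (unblock l)
  generalize (unblock l).take k = u at *
  generalize (unblock l).drop k = v at *
  have hu : ∃ bu : List (E × List F), unblock bu = u := by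
    cases u with
    | nil => exact ⟨[], rfl⟩
    | cons x u =>
      cases l with
      | nil => simp at h0
      | cons b l =>
        simp only [unblock_cons, List.cons_append, List.cons.injEq] at h0
        rw [h0.1]
        exact exists_unblock_cons _ _
  have hv : ∃ bv : List (E × List F), unblock bv = v := by
    cases v with
    | nil => exact ⟨[], rfl⟩
    | cons x v =>
      cases l' with
      | nil => simp at h
      | cons b l =>
        simp only [unblock_cons, List.cons_append, List.cons.injEq] at h
        rw [h.1]
        exact exists_unblock_cons _ _
  obtain ⟨bu, rfl⟩ := hu
  obtain ⟨bv, rfl⟩ := hv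
  rw [← unblock_append] at h h0
  rw [← unblock_injective h, ← unblock_injective h0]
  exact List.isRotated_append

/-- A root of a non-empty concatenation of blocks, unless empty, begins with the same left letter,
so it is again a concatenation of blocks. -/
lemma isPrimitive_unblock (l : List (E × List F)) : IsPrimitive (unblock l) ↔ IsPrimitive l := by
  constructor
  · rintro h ρ m rfl
    exact h _ m (unblock_pow m ρ)
  · intro h ρ m hm
    rcases m with _ | m
    · omega
    cases l with
    | nil => exact absurd rfl h.ne_nil
    | cons b l =>
      have : ∃ bs : List (E × List F), unblock bs = ρ := by
        cases ρ with
        | nil => exact ⟨[], rfl⟩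
        | cons x ρ =>
          simp only [unblock_cons, List.replicate_succ, List.flatten_cons, List.cons_append,
            List.cons.injEq] at hm
          rw [← hm.1]
          exact exists_unblock_cons _ _
      obtain ⟨bs, rfl⟩ := this
      rw [← unblock_pow] at hm
      exact h bs _ (unblock_injective hm)

/-- The concatenation of a cyclic word of blocks. -/
def unblockCycle (c : Cycle (E × List F)) : Cycle (E ⊕ F) :=
  Quotient.map' (s₁ := List.IsRotated.setoid _) (s₂ := List.IsRotated.setoid _) unblock
    (fun _ _ h => unblock_isRotated h) c

lemma unblockCycle_coe (l : List (E × List F)) :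
    unblockCycle (l : Cycle (E × List F)) = (unblock l : Cycle (E ⊕ F)) := rfl

lemma unblockCycle_injective :
    Function.Injective (unblockCycle : Cycle (E × List F) → Cycle (E ⊕ F)) := by
  intro c c'
  induction c using Quotient.inductionOn'
  induction c' using Quotient.inductionOn'
  rename_i l l'
  intro h
  exact Cycle.coe_eq_coe.2 (isRotated_of_unblock (Cycle.coe_eq_coe.1
    (h : ((unblock l : List _) : Cycle (E ⊕ F)) = (unblock l' : List _))))

/-- The relation on blocks induced by a relation on letters. -/
def blockRel (R : E ⊕ F → E ⊕ F → Prop) (b b' : E × List F) : Prop :=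
  (block b ++ [Sum.inl b'.1]).IsChain R

/-- The weight of a block. -/
def blockWeight (w : E ⊕ F → ℝ≥0∞) (b : E × List F) : ℝ≥0∞ := ((block b).map w).prod

/-- `blockRel` tests a block together with the first letter of the next one, so a chain splits at
the left letters, each shared by two pieces. The appended letter closes the last block. -/
lemma isChain_unblock (R : E ⊕ F → E ⊕ F → Prop) (l : List (E × List F)) (b : E × List F) :
    (unblock l ++ [Sum.inl b.1]).IsChain R ↔ (l ++ [b]).IsChain (blockRel R) := by
  induction l with
  | nil => simp
  | cons a l ih =>
    obtain ⟨c, r, hcr⟩ : ∃ c r, l ++ [b] = c :: r := by cases l <;> simp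
    obtain ⟨r', hr'⟩ : ∃ r', unblock l ++ [Sum.inl b.1] = Sum.inl c.1 :: r' := by
      cases l with
      | nil =>
        simp only [List.nil_append, List.cons.injEq] at hcr
        exact ⟨[], by simp [hcr.1]⟩
      | cons d l =>
        simp only [List.cons_append, List.cons.injEq] at hcr
        exact ⟨_, by rw [unblock_cons, ← hcr.1]; rfl⟩
    rw [List.cons_append, hcr, List.isChain_cons_cons, ← hcr, ← ih]
    have : unblock (a :: l) ++ [Sum.inl b.1] = block a ++ (unblock l ++ [Sum.inl b.1]) := by
      simp [unblock]
    rw [this, hr', List.isChain_split, blockRel]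

/-- A cyclic chain is a chain closed by a copy of its first letter: `isChain_unblock` applies with
`b` the first block. -/
lemma unblockCycle_mem_circ (R : E ⊕ F → E ⊕ F → Prop) (c : Cycle (E × List F)) :
    unblockCycle c ∈ circ R ↔ c ∈ circ (blockRel R) := by
  induction c using Quotient.inductionOn'
  rename_i l
  change (unblock l : Cycle (E ⊕ F)) ∈ circ R ↔ (l : Cycle (E × List F)) ∈ circ (blockRel R)
  refine and_congr ?_ ?_
  · cases l with
    | nil => exact Iff.rfl
    | cons b l =>
      have h := isChain_unblock R (b :: l) b
      rw [Cycle.chain_coe_cons, unblock_cons, Cycle.chain_coe_cons]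
      simpa using h
  · rw [isPrimitiveCycle_coe, isPrimitiveCycle_coe, isPrimitive_unblock]

lemma prod_map_unblock (w : E ⊕ F → ℝ≥0∞) (l : List (E × List F)) :
    ((unblock l).map w).prod = (l.map (blockWeight w)).prod := by
  induction l with
  | nil => rfl
  | cons b l ih => simp [ih, blockWeight, block, mul_assoc]

/-- A circuit either stays on the right or is a circuit of blocks. -/
lemma circSum_sum (R : E ⊕ F → E ⊕ F → Prop) (w : E ⊕ F → ℝ≥0∞) :
    circSum R w = circSum (fun a b => R (Sum.inr a) (Sum.inr b)) (fun a => w (Sum.inr a)) +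
      circSum (blockRel R) (blockWeight w) := by
  have hu : circ R = {c | c ∈ circ R ∧ ∀ e, Sum.inl e ∉ c} ∪
      {c | c ∈ circ R ∧ ∃ e, Sum.inl e ∈ c} := by
    ext c
    simp only [Set.mem_union, Set.mem_ofPred_eq, ← and_or_left, ← not_exists]
    exact (and_iff_left (em' _)).symm
  have hd : Disjoint {c | c ∈ circ R ∧ ∀ e, Sum.inl e ∉ c}
      {c | c ∈ circ R ∧ ∃ e, Sum.inl e ∈ c} := by
    rw [Set.disjoint_left]
    rintro c ⟨-, h⟩ ⟨-, e, he⟩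
    exact h e he
  rw [circSum, hu, ENNReal.summable.tsum_union_disjoint
    (f := fun c : Cycle (E ⊕ F) => WGraph.colog (c.toMultiset.map w).prod) hd ENNReal.summable]
  refine congrArg₂ (· + ·) ?_ ?_
  · symm
    refine tsum_eq_of_bijOn (s := circ _) (t := {c | c ∈ circ R ∧ ∀ e, Sum.inl e ∉ c})
      (Cycle.map Sum.inr) ⟨fun c hc => ⟨(map_mem_circ
      Sum.inr_injective (fun _ _ => Iff.rfl) c).2 hc, fun e he => ?_⟩,
      (cycle_map_injective Sum.inr_injective).injOn, fun c hc => ?_⟩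
      (fun c => WGraph.colog (c.toMultiset.map _).prod)
      (fun c => WGraph.colog (c.toMultiset.map w).prod) fun c _ => ?_
    · rw [Cycle.mem_map] at he
      simp at he
    · obtain ⟨c', rfl⟩ := exists_map_eq (f := (Sum.inr : F → E ⊕ F)) (c := c) fun e he => by
        rcases e with e | e
        · exact (hc.2 e he).elim
        · exact ⟨e, rfl⟩
      exact ⟨c', (map_mem_circ Sum.inr_injective (fun _ _ => Iff.rfl) c').1 hc.1, rfl⟩
    · simp only [toMultiset_map_map]
      rfl
  · symm
    refine tsum_eq_of_bijOn (s := circ _) (t := {c | c ∈ circ R ∧ ∃ e, Sum.inl e ∈ c})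
      unblockCycle ⟨fun c hc =>
      ⟨(unblockCycle_mem_circ R c).2 hc, ?_⟩, unblockCycle_injective.injOn, fun c hc => ?_⟩
      (fun c => WGraph.colog (c.toMultiset.map _).prod)
      (fun c => WGraph.colog (c.toMultiset.map w).prod) fun c hc => ?_
    · induction c using Quotient.inductionOn'
      rename_i l
      cases l with
      | nil => exact absurd rfl (hc.2 [] rfl).ne_nil
      | cons b l =>
        exact ⟨b.1, show Sum.inl b.1 ∈ unblock (b :: l) by simp⟩
    · obtain ⟨hc, e, he⟩ := hc
      obtain ⟨c', rfl⟩ : ∃ c', unblockCycle c' = c := by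
        induction c using Quotient.inductionOn'
        rename_i l
        -- Rotate the word so that it begins with a left letter; it is then a concatenation of
        -- blocks.
        obtain ⟨s, t, rfl⟩ := List.append_of_mem (show Sum.inl e ∈ l from he)
        obtain ⟨bs, hbs⟩ := exists_unblock_cons e (t ++ s)
        refine ⟨bs, ?_⟩
        rw [unblockCycle_coe, hbs]
        exact Cycle.coe_eq_coe.2 (List.isRotated_append (l := Sum.inl e :: t) (l' := s))
      exact ⟨c', (unblockCycle_mem_circ R c').1 hc, rfl⟩
    · clear hc
      induction c using Quotient.inductionOn'
      rename_i l
      have := prod_map_unblock w l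
      change WGraph.colog (((unblock l : List _) : Cycle (E ⊕ F)).toMultiset.map w).prod =
        WGraph.colog ((l : Cycle (E × List F)).toMultiset.map (blockWeight w)).prod
      simp [this]

end Words

end GoI

/-! ### Circuits through plugged graphs and reductions -/

namespace GoI

namespace WGraph

variable {α : Type}

/-- The relation between consecutive edges of `X` and `K`, with given relations inside `X` and
inside `K`. -/
def plugRel (X K : WGraph α) (R : X.E → X.E → Prop) (S : K.E → K.E → Prop) :
    X.E ⊕ K.E → X.E ⊕ K.E → Prop
  | .inl a, .inl b => R a b
  | .inr a, .inr b => S a b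
  | .inl a, .inr b => X.tgt a = K.src b
  | .inr a, .inl b => K.tgt a = X.src b

/-- The relation that never holds. -/
def noRel (X : WGraph α) (_ _ : X.E) : Prop := False

/-- The sum over the circuits that use the edges of `X` and `K`. -/
def plugSum (X K : WGraph α) (R : X.E → X.E → Prop) (S : K.E → K.E → Prop) : ℝ≥0∞ :=
  circSum (plugRel X K R S) (Sum.elim X.w K.w)

lemma plugSum_comm (X K : WGraph α) (R : X.E → X.E → Prop) (S : K.E → K.E → Prop) :
    plugSum X K R S = plugSum K X S R := by
  refine circSum_equiv (Equiv.sumComm _ _) ?_ ?_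
  · rintro (a | a) (b | b) <;> rfl
  · rintro (a | a) <;> rfl

lemma blockRel_nil {E F : Type} (R : E ⊕ F → E ⊕ F → Prop) (e : E) (b : E × List F) :
    blockRel R (e, []) b ↔ R (Sum.inl e) (Sum.inl b.1) := by
  simp [blockRel, block]

/-- Separates entering the run, staying in it and leaving it; this is how an edge of a reduction
sits between two edges of a third graph. -/
lemma blockRel_of_ne_nil {E F : Type} (R : E ⊕ F → E ⊕ F → Prop) (e : E) (m : List F)
    (h : m ≠ []) (b : E × List F) :
    blockRel R (e, m) b ↔ R (Sum.inl e) (Sum.inr (m.head h)) ∧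
      m.IsChain (fun x y => R (Sum.inr x) (Sum.inr y)) ∧
      R (Sum.inr (m.getLast h)) (Sum.inl b.1) := by
  have h1 : m.map (Sum.inr : F → E ⊕ F) ≠ [] := by simpa using h
  rw [blockRel, block, List.cons_append, List.isChain_cons, List.isChain_append, List.isChain_map]
  rw [List.head?_append_of_ne_nil _ h1, List.head?_eq_some_head h1, List.getLast?_eq_some_getLast h1]
  simp

variable [DecidableEq α]

/-- Consecutive edges of an alternating path. -/
def altRel (G H : WGraph α) (e f : (G.union H).E) : Prop :=
  (G.union H).tgt e = (G.union H).src f ∧ color G H e ≠ color G H f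

lemma isAltPath_iff (G H : WGraph α) (l : List (G.union H).E) :
    IsAltPath G H l ↔ l ≠ [] ∧ l.IsChain (altRel G H) := by
  unfold IsAltPath IsPath
  rw [and_assoc]
  refine and_congr_right fun _ => ?_
  induction l with
  | nil => simp
  | cons a l ih =>
    cases l with
    | nil => simp
    | cons b l =>
      simp only [List.isChain_cons_cons, altRel] at ih ⊢
      tauto

/-- A `1`-cycle only excludes roots that are cycles, while primitivity excludes all roots. The two
agree: a root repeated at least twice is followed by itself, and this junction closes it into a
cycle. -/
lemma exists_isAltOneCycle_iff (G H : WGraph α) (c : Cycle (G.union H).E) :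
    (∃ l : List (G.union H).E, (l : Cycle (G.union H).E) = c ∧ IsAltOneCycle G H l) ↔
      c ∈ circ (altRel G H) := by
  have key : ∀ l : List (G.union H).E, IsAltOneCycle G H l ↔
      (l : Cycle (G.union H).E) ∈ circ (altRel G H) := by
    intro l
    by_cases hl : l = []
    · subst hl
      refine iff_of_false (fun h => h.1.1.1 rfl) fun h => (h.2 [] rfl).ne_nil rfl
    unfold IsAltOneCycle IsKCycle IsCycle circ
    rw [isAltPath_iff, Set.mem_ofPred_eq, isPrimitiveCycle_coe, Cycle.chain_ne_nil _ hl]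
    have hch : List.IsChain (altRel G H) (l.getLast hl :: l) ↔
        altRel G H (l.getLast hl) (l.head hl) ∧ l.IsChain (altRel G H) := by
      cases l with
      | nil => exact absurd rfl hl
      | cons a l => rw [List.isChain_cons_cons]; rfl
    rw [hch]
    constructor
    · rintro ⟨⟨-, h1⟩, ⟨⟨h2, h, h3⟩, -, h4⟩, h', h5⟩
      refine ⟨⟨⟨h3, h5⟩, h1⟩, fun ρ m hm => ?_⟩
      by_contra hm1
      obtain ⟨m, rfl⟩ : ∃ k, m = k + 2 := ⟨m - 2, by omega⟩
      refine hm1 (h4 ⟨ρ, ?_, hm⟩)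
      have hρ : ρ ≠ [] := by
        rintro rfl
        simp at hm
        exact hl hm
      subst hm
      have hc : (ρ ++ (ρ ++ (List.replicate m ρ).flatten)).IsChain
          (fun e f => (G.union H).tgt e = (G.union H).src f) := by
        simpa [List.replicate_succ] using h2.2
      refine ⟨⟨hρ, hc.left_of_append⟩, hρ, ?_⟩
      rw [List.isChain_append] at hc
      refine hc.2.2 _ (List.getLast_mem_getLast? hρ) _ ?_
      rw [List.head?_append_of_ne_nil _ hρ]
      exact List.head_mem_head? hρ
    · rintro ⟨⟨⟨h3, h5⟩, h1⟩, hp⟩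
      have h2 : (G.union H).IsPath l := ((isAltPath_iff G H l).2 ⟨hl, h1⟩).1
      refine ⟨⟨hl, h1⟩, ⟨⟨h2, hl, h3⟩, ⟨l, ⟨h2, hl, h3⟩, by simp⟩, ?_⟩, hl, h5⟩
      rintro m ⟨ρ, -, hm⟩
      exact hp ρ m hm
  constructor
  · rintro ⟨l, rfl, h⟩
    exact (key l).1 h
  · intro h
    induction c using Quotient.inductionOn'
    rename_i l
    exact ⟨l, rfl, (key l).2 h⟩

lemma interaction_eq_circSum (G H : WGraph α) :
    interaction G H = circSum (altRel G H) (G.union H).w := by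
  unfold interaction circSum
  rw [← (Equiv.subtypeEquivRight (exists_isAltOneCycle_iff G H)).tsum_eq]
  rfl

/-- Alternation forbids two consecutive edges of the same graph, so both inner relations are empty.
-/
lemma altRel_eq_plugRel (G H : WGraph α) : altRel G H = plugRel G H G.noRel H.noRel := by
  ext (a | a) (b | b) <;> simp [altRel, plugRel, noRel, union, color]

lemma interaction_eq_plugSum (G H : WGraph α) :
    interaction G H = plugSum G H G.noRel H.noRel := by
  rw [interaction_eq_circSum, altRel_eq_plugRel]
  rfl

/-- Expansion of the edges of a reduction: a circuit through `G`, `H` and a third graph either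
stays in `G` and `H` or is a circuit through the reduction of `G` and `H`. -/
lemma plugSum_reduction (X G H : WGraph α) (R : X.E → X.E → Prop)
    (hX : ∀ v ∈ X.V, v ∈ G.V → v ∈ H.V → False) :
    plugSum X (G.reduction H) R (noRel _) + interaction G H =
      plugSum X (G.union H) R (altRel G H) := by
  -- Common code for the blocks of both sides: an edge of `X` followed by at most one edge of the
  -- reduction. `none` means that the next edge is again in `X`.
  set S : X.E × Option (G.reduction H).E → X.E × Option (G.reduction H).E → Prop := fun p q =>
    p.2.elim (R p.1 q.1)
      (fun l => X.tgt p.1 = (G.reduction H).src l ∧ (G.reduction H).tgt l = X.src q.1) with hS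
  set v : X.E × Option (G.reduction H).E → ℝ≥0∞ := fun p =>
    X.w p.1 * p.2.elim 1 (G.reduction H).w with hv
  have hmem : ∀ u ∈ X.V, u ∈ (G.union H).V → u ∈ symmDiff G.V H.V := by
    intro u hu huK
    have := hX u hu
    simp only [union, Finset.mem_union] at huK
    rw [Finset.mem_symmDiff]
    tauto
  unfold plugSum
  -- Cut both sums before the edges of `X`. The circuits that avoid `X` contribute nothing on the
  -- reduction side, and exactly `interaction G H` on the side of the union.
  rw [circSum_sum, circSum_sum, interaction_eq_circSum,
    circSum_eq_zero (R := fun a b => plugRel X (G.reduction H) R (noRel _) (Sum.inr a) (Sum.inr b))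
      (fun _ _ _ h _ => h), zero_add, add_comm]
  refine congrArg₂ (· + ·) rfl ?_
  trans circSum S v
  · symm
    refine circSum_embed (fun p => (p.1, p.2.toList)) ?_ ?_ ?_ ?_
    · rintro ⟨a, o⟩ ⟨b, o'⟩ h
      cases o <;> cases o' <;> simp_all
    · rintro ⟨a, o⟩ ⟨b, o'⟩
      cases o with
      | none => simp [hS, blockRel_nil, plugRel]
      | some l => simp [hS, blockRel_of_ne_nil, plugRel]
    · rintro ⟨a, o⟩
      cases o <;> simp [hv, blockWeight, block]
    · rintro ⟨e, m⟩ a b - h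
      match m with
      | [] => exact ⟨(e, none), rfl⟩
      | [l] => exact ⟨(e, some l), rfl⟩
      | l :: l' :: m =>
        rw [blockRel_of_ne_nil _ _ _ (List.cons_ne_nil _ _)] at h
        simp [plugRel, noRel] at h
  · refine circSum_embed (fun p => (p.1, p.2.elim [] (fun l => l.1))) ?_ ?_ ?_ ?_
    · rintro ⟨a, o⟩ ⟨b, o'⟩ h
      simp only [Prod.mk.injEq] at h
      obtain ⟨rfl, h⟩ := h
      rcases o with _ | l <;> rcases o' with _ | l'
      · rfl
      · exact absurd h.symm l'.2.2.1
      · exact absurd h l.2.2.1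
      · rw [Subtype.ext h]
    · rintro ⟨a, o⟩ ⟨b, o'⟩
      rcases o with _ | l
      · simp [hS, blockRel_nil, plugRel]
      · simp only [hS, Option.elim_some]
        rw [blockRel_of_ne_nil _ _ _ l.2.2.1]
        have : List.IsChain (altRel G H) l.1 := ((isAltPath_iff G H l.1).1 l.2.1).2
        exact ⟨fun h => ⟨h.1, this, h.2⟩, fun h => ⟨h.1, h.2.2⟩⟩
    · rintro ⟨a, o⟩
      rcases o with _ | l
      · simp [hv, blockWeight, block]
      · simp [hv, blockWeight, block, reduction, pathWeight, Function.comp_def]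
        rfl
    · rintro ⟨e, m⟩ a b - h
      by_cases hm : m = []
      · subst hm
        exact ⟨(e, none), rfl⟩
      · rw [blockRel_of_ne_nil _ _ _ hm] at h
        obtain ⟨h1, h2, h3⟩ := h
        -- A run between two edges of `X` has both ends in `X.V`, so by `hmem` its ends survive in
        -- the reduction and the run is one of its edges.
        refine ⟨(e, some ⟨m, (isAltPath_iff G H m).2 ⟨hm, h2⟩, hm, ?_, ?_⟩), rfl⟩
        · refine hmem _ ?_ ((G.union H).src_mem _)
          change X.tgt e = _ at h1
          rw [← h1]
          exact X.tgt_mem e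
        · refine hmem _ ?_ ((G.union H).tgt_mem _)
          change _ = X.src b.1 at h3
          rw [h3]
          exact X.src_mem _

end WGraph

end GoI

/-! ### Interactions of unions and reductions -/

namespace GoI

namespace WGraph

variable {α : Type}

lemma tgt_ne_src {G H : WGraph α} (h : Disjoint G.V H.V) (a : G.E) (b : H.E) :
    G.tgt a ≠ H.src b :=
  fun hab => Finset.disjoint_left.1 h (G.tgt_mem a) (hab ▸ H.src_mem b)

lemma Same.refl (G : WGraph α) : G.Same G := ⟨rfl, Equiv.refl _, fun _ => ⟨rfl, rfl, rfl⟩⟩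

lemma Same.symm {G H : WGraph α} (h : G.Same H) : H.Same G := by
  obtain ⟨hV, φ, hφ⟩ := h
  refine ⟨hV.symm, φ.symm, fun e => ?_⟩
  obtain ⟨h1, h2, h3⟩ := hφ (φ.symm e)
  rw [Equiv.apply_symm_apply] at h1 h2 h3
  exact ⟨h1.symm, h2.symm, h3.symm⟩

lemma Same.trans {G H K : WGraph α} (h : G.Same H) (h' : H.Same K) : G.Same K := by
  obtain ⟨hV, φ, hφ⟩ := h
  obtain ⟨hV', ψ, hψ⟩ := h'
  refine ⟨hV.trans hV', φ.trans ψ, fun e => ?_⟩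
  obtain ⟨h1, h2, h3⟩ := hφ e
  obtain ⟨h1', h2', h3'⟩ := hψ (φ e)
  exact ⟨h1'.trans h1, h2'.trans h2, h3'.trans h3⟩

variable [DecidableEq α]

lemma Same.union {G G' H H' : WGraph α} (h : G.Same G') (h' : H.Same H') :
    (G.union H).Same (G'.union H') := by
  obtain ⟨hV, φ, hφ⟩ := h
  obtain ⟨hV', ψ, hψ⟩ := h'
  refine ⟨congrArg₂ (· ∪ ·) hV hV', Equiv.sumCongr φ ψ, ?_⟩
  rintro (e | e)
  · exact hφ e
  · exact hψ e

lemma union_comm_same (G H : WGraph α) : (G.union H).Same (H.union G) := by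
  refine ⟨Finset.union_comm _ _, Equiv.sumComm _ _, ?_⟩
  rintro (e | e) <;> exact ⟨rfl, rfl, rfl⟩

lemma union_assoc_same (G H K : WGraph α) :
    ((G.union H).union K).Same (G.union (H.union K)) := by
  refine ⟨Finset.union_assoc _ _ _, Equiv.sumAssoc _ _ _, ?_⟩
  rintro ((e | e) | e) <;> exact ⟨rfl, rfl, rfl⟩

lemma union_same_of_eq_empty {G : WGraph α} (h : G.V = ∅) (H : WGraph α) :
    (G.union H).Same H := by
  have : IsEmpty G.E := ⟨fun e => by simpa [h] using G.src_mem e⟩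
  refine ⟨(congrArg (· ∪ H.V) h).trans (Finset.empty_union _), Equiv.emptySum _ _, ?_⟩
  rintro (e | e)
  · exact isEmptyElim e
  · exact ⟨rfl, rfl, rfl⟩

lemma interaction_comm (G H : WGraph α) : interaction G H = interaction H G := by
  rw [interaction_eq_plugSum, interaction_eq_plugSum, plugSum_comm]

lemma Same.interaction_left {G G' : WGraph α} (h : G.Same G') (H : WGraph α) :
    interaction G H = interaction G' H := by
  obtain ⟨-, φ, hφ⟩ := h
  rw [interaction_eq_plugSum, interaction_eq_plugSum]
  refine circSum_equiv (Equiv.sumCongr φ (Equiv.refl _)) ?_ ?_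
  · rintro (a | a) (b | b) <;> simp [plugRel, noRel, hφ]
  · rintro (a | a) <;> simp [hφ]

lemma interaction_of_disjoint {G H : WGraph α} (h : Disjoint G.V H.V) : interaction G H = 0 := by
  rw [interaction_eq_plugSum]
  refine circSum_eq_zero ?_
  rintro (a | a) (b | b) - hab - <;> simp only [plugRel, noRel] at hab
  · exact tgt_ne_src h _ _ hab
  · exact tgt_ne_src h.symm _ _ hab

lemma interaction_edgeless (G : WGraph α) (V : Finset α) : interaction G (edgeless V) = 0 := by
  rw [interaction_eq_plugSum]
  refine circSum_eq_zero ?_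
  rintro (a | a) (b | b) - hab - <;> simp only [plugRel, noRel] at hab
  · exact b.elim
  · exact a.elim

/-- The three-term adjunction. -/
lemma interaction_union_right (F A B : WGraph α) (h : Disjoint A.V B.V) :
    interaction F (A.union B) = interaction F A + interaction (F.reduction A) B := by
  have h1 := tgt_ne_src h
  have h2 := tgt_ne_src h.symm
  rw [interaction_comm (F.reduction A) B, interaction_eq_plugSum B, add_comm,
    plugSum_reduction B F A _ fun v hB _ hA => Finset.disjoint_left.1 h hA hB,
    interaction_eq_plugSum]
  -- Both sums run over the edges of `F`, `A` and `B`. The relations differ only on consecutive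
  -- edges of `A` and `B`, and disjointness rules these out.
  refine circSum_equiv ((Equiv.sumAssoc _ _ _).symm.trans (Equiv.sumComm _ _)) ?_ ?_
  · rintro (a | a | a) (b | b | b) <;> simp [plugRel, altRel, noRel, union, color, h1, h2]
  · rintro (a | a | a) <;> rfl

/-- The interaction with a tensor product of two graphs after a cut. -/
lemma interaction_reduction_union (P Q D G : WGraph α) (hDG : Disjoint D.V G.V)
    (hPG : Disjoint P.V G.V) (hQD : Disjoint Q.V D.V) :
    interaction (P.reduction Q) (D.union G) + interaction P Q =
      interaction (P.reduction D) (Q.reduction G) + interaction P D + interaction Q G := by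
  have h1 := tgt_ne_src hDG
  have h2 := tgt_ne_src hDG.symm
  have h3 := tgt_ne_src hPG
  have h4 := tgt_ne_src hPG.symm
  have h5 := tgt_ne_src hQD
  have h6 := tgt_ne_src hQD.symm
  rw [Finset.disjoint_left] at hDG hPG hQD
  rw [interaction_comm (P.reduction Q), interaction_eq_plugSum (D.union G),
    plugSum_reduction (D.union G) P Q, interaction_eq_plugSum (P.reduction D), add_right_comm,
    plugSum_reduction (P.reduction D) Q G, plugSum_comm (P.reduction D),
    plugSum_reduction (Q.union G) P D]
  -- With all reductions expanded, disjointness leaves on both sides only the adjacencies `P`-`Q`,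
  -- `P`-`D` and `Q`-`G`.
  · refine circSum_equiv (E := (D.E ⊕ G.E) ⊕ (P.E ⊕ Q.E)) (F := (Q.E ⊕ G.E) ⊕ (P.E ⊕ D.E))
      ((Equiv.sumComm _ _).trans ((Equiv.sumSumSumComm _ _ _ _).trans
        ((Equiv.sumComm _ _)))) ?_ ?_
    · rintro ((a | a) | (a | a)) ((b | b) | (b | b)) <;>
        simp [plugRel, altRel, noRel, union, color, h1, h2, h3, h4, h5, h6]
    · rintro ((a | a) | (a | a)) <;> rfl
  · intro v h h' h''
    rcases Finset.mem_union.1 h with h | h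
    · exact hQD h h''
    · exact hDG h'' h
  · intro v h h' h''
    rcases Finset.mem_symmDiff.1 h with h | h
    · exact hPG h.1 h''
    · exact hDG h.1 h''
  · intro v h h' h''
    rcases Finset.mem_union.1 h with h | h
    · exact hQD h'' h
    · exact hPG h' h

/-- The relation between consecutive edges of `X` and `K`, on the edges of the union. -/
def unionRel (X K : WGraph α) (R : X.E → X.E → Prop) (S : K.E → K.E → Prop) :
    (X.union K).E → (X.union K).E → Prop := plugRel X K R S

/-- The interaction of a tensor product of two graphs with a test of three components. -/
lemma interaction_union_union (P Q T D G : WGraph α) (hDG : Disjoint D.V G.V)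
    (hPG : Disjoint P.V G.V) (hQD : Disjoint Q.V D.V) (hPQ : Disjoint P.V Q.V)
    (hTD : Disjoint T.V D.V) (hTG : Disjoint T.V G.V) :
    interaction (P.union Q) (T.union (D.union G)) =
      interaction ((P.reduction D).union (Q.reduction G)) T + interaction P D +
        interaction Q G := by
  have hred : Disjoint (P.reduction D).V (Q.reduction G).V := by
    rw [Finset.disjoint_left] at *
    intro v h h'
    rcases Finset.mem_symmDiff.1 h with h | h <;> rcases Finset.mem_symmDiff.1 h' with h' | h'
    · exact hPQ h.1 h'.1
    · exact hPG h.1 h'.1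
    · exact hQD h'.1 h.1
    · exact hDG h.1 h'.1
  -- Reductions are expanded one at a time: `e1` isolates `P.reduction D`, and `e2` regroups the
  -- result to isolate `Q.reduction G`.
  have e1 : interaction ((P.reduction D).union (Q.reduction G)) T =
      plugSum (T.union (Q.reduction G)) (P.reduction D)
        (unionRel T (Q.reduction G) (noRel _) (noRel _)) (noRel _) := by
    have h1 := tgt_ne_src hred
    have h2 := tgt_ne_src hred.symm
    rw [interaction_eq_plugSum]
    refine circSum_equiv ((Equiv.sumAssoc _ _ _).trans ((Equiv.sumComm _ _).trans
      (Equiv.sumCongr (Equiv.sumComm _ _) (Equiv.refl _)))) ?_ ?_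
    · rintro ((a | a) | a) ((b | b) | b) <;> simp [unionRel, plugRel, noRel, union, h1, h2]
    · rintro ((a | a) | a) <;> rfl
  have e2 : plugSum (T.union (Q.reduction G)) (P.union D)
        (unionRel T (Q.reduction G) (noRel _) (noRel _)) (altRel P D) =
      plugSum (T.union (P.union D)) (Q.reduction G)
        (unionRel T (P.union D) (noRel _) (altRel P D)) (noRel _) := by
    refine circSum_equiv ((Equiv.sumAssoc _ _ _).trans ((Equiv.sumCongr (Equiv.refl _)
      (Equiv.sumComm _ _)).trans (Equiv.sumAssoc _ _ _).symm)) ?_ ?_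
    · rintro ((a | a) | a) ((b | b) | b) <;> rfl
    · rintro ((a | a) | a) <;> rfl
  have h1 := tgt_ne_src hDG
  have h2 := tgt_ne_src hDG.symm
  have h3 := tgt_ne_src hPG
  have h4 := tgt_ne_src hPG.symm
  have h5 := tgt_ne_src hQD
  have h6 := tgt_ne_src hQD.symm
  have h7 := tgt_ne_src hPQ
  have h8 := tgt_ne_src hPQ.symm
  have h9 := tgt_ne_src hTD
  have h10 := tgt_ne_src hTD.symm
  have h11 := tgt_ne_src hTG
  have h12 := tgt_ne_src hTG.symm
  rw [Finset.disjoint_left] at hDG hPG hQD hPQ hTD hTG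
  rw [e1, plugSum_reduction (T.union (Q.reduction G)) P D, e2,
    plugSum_reduction (T.union (P.union D)) Q G, interaction_eq_plugSum]
  · refine circSum_equiv (E := (P.E ⊕ Q.E) ⊕ (T.E ⊕ (D.E ⊕ G.E)))
      (F := (T.E ⊕ (P.E ⊕ D.E)) ⊕ (Q.E ⊕ G.E))
      ⟨fun
        | .inl (.inl a) => .inl (.inr (.inl a))
        | .inl (.inr a) => .inr (.inl a)
        | .inr (.inl a) => .inl (.inl a)
        | .inr (.inr (.inl a)) => .inl (.inr (.inr a))
        | .inr (.inr (.inr a)) => .inr (.inr a),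
      fun
        | .inl (.inr (.inl a)) => .inl (.inl a)
        | .inr (.inl a) => .inl (.inr a)
        | .inl (.inl a) => .inr (.inl a)
        | .inl (.inr (.inr a)) => .inr (.inr (.inl a))
        | .inr (.inr a) => .inr (.inr (.inr a)),
      by rintro ((a | a) | (a | a | a)) <;> rfl, by rintro ((a | a | a) | (a | a)) <;> rfl⟩ ?_ ?_
    · rintro ((a | a) | (a | a | a)) ((b | b) | (b | b | b)) <;>
        simp [unionRel, plugRel, altRel, noRel, union, color, h1, h2, h3, h4, h5, h6, h7, h8, h9, h10, h11,
          h12]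
    · rintro ((a | a) | (a | a | a)) <;> rfl
  · intro v h h' h''
    rcases Finset.mem_union.1 h with h | h
    · exact hTG h h''
    · rcases Finset.mem_union.1 h with h | h
      · exact hPQ h h'
      · exact hQD h' h
  · intro v h h' h''
    rcases Finset.mem_union.1 h with h | h
    · exact hTD h h''
    · rcases Finset.mem_symmDiff.1 h with h | h
      · exact hPQ h' h.1
      · exact hPG h' h.1

end WGraph

/-- A circuit that leaves the left side has to step from left to right, which is forbidden; so every
block on a circuit has an empty run. -/
lemma circSum_of_not_rel {E F : Type} (R : E ⊕ F → E ⊕ F → Prop) (w : E ⊕ F → ℝ≥0∞)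
    (h : ∀ a b, ¬ R (Sum.inl a) (Sum.inr b)) :
    circSum R w = circSum (fun a b => R (Sum.inl a) (Sum.inl b)) (fun a => w (Sum.inl a)) +
      circSum (fun a b => R (Sum.inr a) (Sum.inr b)) (fun a => w (Sum.inr a)) := by
  rw [circSum_sum, add_comm]
  congr 1
  symm
  refine circSum_embed (fun e => (e, [])) (fun a b hab => (Prod.mk.inj hab).1) (fun a b => ?_)
    (fun a => by simp [blockWeight, block]) ?_
  · rw [WGraph.blockRel_nil]
  · rintro ⟨e, m⟩ a b - hb
    by_cases hm : m = []
    · exact ⟨e, by rw [hm]⟩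
    · rw [WGraph.blockRel_of_ne_nil _ _ _ hm] at hb
      exact (h _ _ hb.1).elim

namespace WGraph

variable {α : Type} [DecidableEq α]

/-- No alternating step joins the pair `P`, `D` to the pair `Q`, `G`, so no circuit uses both. This
is the identity behind mix. -/
lemma interaction_union_of_disjoint (P Q D G : WGraph α) (hPG : Disjoint P.V G.V)
    (hQD : Disjoint Q.V D.V) :
    interaction (P.union Q) (D.union G) = interaction P D + interaction Q G := by
  have h1 := tgt_ne_src hPG
  have h2 := tgt_ne_src hPG.symm
  have h3 := tgt_ne_src hQD
  have h4 := tgt_ne_src hQD.symm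
  simp only [interaction_eq_plugSum]
  trans circSum (E := (P.E ⊕ D.E) ⊕ (Q.E ⊕ G.E))
    (fun
      | .inl a, .inl b => plugRel P D (noRel _) (noRel _) a b
      | .inr a, .inr b => plugRel Q G (noRel _) (noRel _) a b
      | _, _ => False) (Sum.elim (Sum.elim P.w D.w) (Sum.elim Q.w G.w))
  · refine circSum_equiv (Equiv.sumSumSumComm _ _ _ _) ?_ ?_
    · rintro ((a | a) | (a | a)) ((b | b) | (b | b)) <;>
        simp [plugRel, noRel, union, h1, h2, h3, h4]
    · rintro ((a | a) | (a | a)) <;> rfl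
  · exact circSum_of_not_rel _ _ fun _ _ => id

end WGraph

end GoI

/-! ### Measurements of projects -/

namespace GoI

namespace Project

variable {α β : Type}

/-- Equality of projects up to a renaming of the edges. -/
def Same (a b : Project α) : Prop := a.wager = b.wager ∧ a.graph.Same b.graph

lemma Same.refl (a : Project α) : a.Same a := ⟨rfl, .refl _⟩

lemma Same.symm {a b : Project α} (h : a.Same b) : b.Same a := ⟨h.1.symm, h.2.symm⟩

lemma Same.trans {a b c : Project α} (h : a.Same b) (h' : b.Same c) : a.Same c :=
  ⟨h.1.trans h'.1, h.2.trans h'.2⟩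

variable [DecidableEq α] [DecidableEq β]

lemma sca_comm (a b : Project α) : sca a b = sca b a := by
  rw [sca, sca, WGraph.interaction_comm, add_comm (a.wager : ℝ≥0∞)]

lemma Orthogonal.symm {a b : Project α} (h : a.Orthogonal b) : b.Orthogonal a := by
  rw [Orthogonal, sca_comm]
  exact ⟨h.1.symm, h.2⟩

lemma Same.sca_left {a a' : Project α} (h : a.Same a') (b : Project α) :
    sca a b = sca a' b := by
  rw [sca, sca, h.1, h.2.interaction_left]

lemma Same.orthogonal_left {a a' b : Project α} (h : a.Same a') (hb : a'.Orthogonal b) :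
    a.Orthogonal b := by
  rw [Orthogonal, h.sca_left]
  exact ⟨h.2.1.trans hb.1, hb.2⟩

/-- The juxtaposition of two projects: their tensor product when the carriers are disjoint. -/
def juxt (a b : Project α) : Project α :=
  ⟨a.wager + b.wager, a.graph.union b.graph, WGraph.union_w_le_one a.w_le_one b.w_le_one⟩

/-- The cut of two projects, with a junk wager when their interaction is infinite. -/
def exec (a b : Project α) : Project α :=
  ⟨(sca a b).toNNReal, a.graph.reduction b.graph, fun l =>
    WGraph.pathWeight_le_one _ (WGraph.union_w_le_one a.w_le_one b.w_le_one) l.1⟩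

lemma tensor_eq_some {a b : Project α} (h : Disjoint a.carrier b.carrier) :
    Project.tensor a b = some (juxt a b) := by
  rw [Project.tensor, if_pos h, juxt]
  congr 2
  rw [sca, WGraph.interaction_of_disjoint h, add_zero, ← ENNReal.coe_add, ENNReal.toNNReal_coe]

lemma cut_eq_some {a b : Project α} (h : sca a b ≠ ⊤) : Project.cut a b = some (exec a b) :=
  if_pos h

lemma exec_wager {a b : Project α} (h : sca a b ≠ ⊤) :
    ((exec a b).wager : ℝ≥0∞) = a.wager + b.wager + a.graph.interaction b.graph :=
  ENNReal.coe_toNNReal h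

lemma juxt_same {a a' b b' : Project α} (h : a.Same a') (h' : b.Same b') :
    (juxt a b).Same (juxt a' b') :=
  ⟨congrArg₂ (· + ·) h.1 h'.1, h.2.union h'.2⟩

lemma juxt_comm_same (a b : Project α) : (juxt a b).Same (juxt b a) :=
  ⟨add_comm _ _, WGraph.union_comm_same _ _⟩

lemma juxt_assoc_same (a b c : Project α) : (juxt (juxt a b) c).Same (juxt a (juxt b c)) :=
  ⟨add_assoc _ _ _, WGraph.union_assoc_same _ _ _⟩

lemma zero_juxt_same (a : Project α) : (juxt zero a).Same a :=
  ⟨zero_add _, WGraph.union_same_of_eq_empty rfl _⟩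

lemma juxt_zero_same (a : Project α) : (juxt a zero).Same a :=
  (juxt_comm_same _ _).trans (zero_juxt_same a)

lemma sca_juxt_right' (f a b : Project α) (h : Disjoint a.carrier b.carrier) :
    sca f (juxt a b) = f.wager + a.wager + f.graph.interaction a.graph + b.wager +
      (f.graph.reduction a.graph).interaction b.graph := by
  rw [sca, juxt, WGraph.interaction_union_right _ _ _ h]
  push_cast
  ring

/-- Used to show that cuts are defined: a finite measurement against a larger test bounds the
partial one. -/
lemma sca_le_sca_juxt (f a b : Project α) (h : Disjoint a.carrier b.carrier) :
    sca f a ≤ sca f (juxt a b) := by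
  rw [sca_juxt_right' f a b h, add_assoc, sca]
  exact le_self_add

/-- The adjunction with wagers. Finiteness of `sca f a` makes the wager of `exec f a`, a `toNNReal`,
the true value. -/
lemma sca_juxt_right {f a b : Project α} (h : Disjoint a.carrier b.carrier)
    (hfa : sca f a ≠ ⊤) : sca f (juxt a b) = sca (exec f a) b := by
  rw [sca_juxt_right' f a b h, sca, exec_wager hfa]
  rfl

/-- The identity behind the cut rule. The measurement of `p` against `q` is a summand of a finite
quantity, so the cut of `p` and `q` comes out defined. -/
lemma sca_exec_exec {p q d g : Project α} (hdg : Disjoint d.carrier g.carrier)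
    (hpg : Disjoint p.carrier g.carrier) (hqd : Disjoint q.carrier d.carrier)
    (hpd : sca p d ≠ ⊤) (hqg : sca q g ≠ ⊤) (h : sca (exec p d) (exec q g) ≠ ⊤) :
    sca p q ≠ ⊤ ∧ sca (exec p q) (juxt d g) = sca (exec p d) (exec q g) := by
  have key := WGraph.interaction_reduction_union p.graph q.graph d.graph g.graph hdg hpg hqd
  have h1 : sca (exec p d) (exec q g) = sca p q +
      (d.wager + g.wager + (p.graph.reduction q.graph).interaction (d.graph.union g.graph)) := by
    rw [sca, exec_wager hpd, exec_wager hqg, sca]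
    calc _ = (p.wager : ℝ≥0∞) + q.wager + d.wager + g.wager +
        ((p.graph.reduction d.graph).interaction (q.graph.reduction g.graph) +
          p.graph.interaction d.graph + q.graph.interaction g.graph) := by
            simp only [exec]; ring
      _ = _ := by rw [← key]; ring
  have hpq : sca p q ≠ ⊤ := fun h0 => h (by rw [h1, h0, top_add])
  refine ⟨hpq, ?_⟩
  rw [h1, sca, exec_wager hpq, sca, juxt]
  simp only [exec]
  push_cast
  ring

lemma sca_juxt_juxt_juxt {p q t d g : Project α} (hdg : Disjoint d.carrier g.carrier)
    (hpg : Disjoint p.carrier g.carrier) (hqd : Disjoint q.carrier d.carrier)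
    (hpq : Disjoint p.carrier q.carrier) (htd : Disjoint t.carrier d.carrier)
    (htg : Disjoint t.carrier g.carrier) (hpd : sca p d ≠ ⊤) (hqg : sca q g ≠ ⊤) :
    sca (juxt p q) (juxt t (juxt d g)) = sca (juxt (exec p d) (exec q g)) t := by
  rw [sca, sca, juxt, juxt, juxt, juxt]
  simp only [ENNReal.coe_add]
  rw [exec_wager hpd, exec_wager hqg, WGraph.interaction_union_union _ _ _ _ _ hdg hpg hqd hpq
    htd htg]
  simp only [exec]
  ring

lemma sca_juxt_juxt {p q g d : Project α} (hpd : Disjoint p.carrier d.carrier)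
    (hqg : Disjoint q.carrier g.carrier) :
    sca (juxt p q) (juxt g d) = sca p g + sca q d := by
  rw [sca, sca, sca, juxt, juxt]
  simp only [ENNReal.coe_add]
  rw [WGraph.interaction_union_of_disjoint _ _ _ _ hpd hqg]
  ring

lemma sca_edgeless (a : Project α) (r : ℝ≥0) (V : Finset α) :
    sca a ⟨r, WGraph.edgeless V, fun e => e.elim⟩ = a.wager + r := by
  rw [sca, WGraph.interaction_edgeless, add_zero]

lemma sca_deloc (φ : α ↪ β) (a b : Project α) : sca (deloc φ a) (deloc φ b) = sca a b := by
  unfold sca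
  refine congrArg₂ (· + ·) rfl ?_
  rw [WGraph.interaction_eq_plugSum, WGraph.interaction_eq_plugSum]
  refine circSum_equiv (E := a.graph.E ⊕ b.graph.E) (F := a.graph.E ⊕ b.graph.E)
    (Equiv.refl _) ?_ ?_
  · rintro (e | e) (f | f) <;> simp [WGraph.plugRel, WGraph.noRel, deloc, WGraph.deloc]
  · rintro (e | e) <;> rfl

-- Sources and targets lie in the image of `V`, so they factor through `φ`. This gives equality, not
-- just an inclusion, in `orth_deloc`.
omit [DecidableEq α] [DecidableEq β] in
lemma exists_deloc_eq (φ : α ↪ β) {V : Finset α} {b : Project β} (h : b.carrier = V.map φ) :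
    ∃ a : Project α, a.carrier = V ∧ deloc φ a = b := by
  obtain ⟨r, ⟨W, E, hE, s, t, hs, ht, w, hw⟩, hle⟩ := b
  change W = V.map φ at h
  subst h
  obtain ⟨s, rfl⟩ : ∃ s' : E → α, φ ∘ s' = s := by
    choose s' _ h' using fun e => Finset.mem_map.1 (hs e)
    exact ⟨s', funext h'⟩
  obtain ⟨t, rfl⟩ : ∃ t' : E → α, φ ∘ t' = t := by
    choose s' _ h' using fun e => Finset.mem_map.1 (ht e)
    exact ⟨s', funext h'⟩
  exact ⟨⟨r, ⟨V, E, hE, s, t, fun e => (Finset.mem_map' φ).1 (hs e),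
    fun e => (Finset.mem_map' φ).1 (ht e), w, hw⟩, hle⟩, rfl, rfl⟩

end Project

/-! ### Orthogonality and conducts -/

namespace ProjectSet

open Project

variable {α β : Type}

/-- All the projects have the same carrier. -/
def HasCarrier (S : ProjectSet α) : Prop := ∀ a ∈ S.projects, a.carrier = S.carrier

variable [DecidableEq α] [DecidableEq β]

omit [DecidableEq α] in
lemma ext' {S T : ProjectSet α} (h : S.carrier = T.carrier)
    (h' : ∀ a, a ∈ S.projects ↔ a ∈ T.projects) : S = T := by
  obtain ⟨V, P⟩ := S
  obtain ⟨W, Q⟩ := T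
  obtain rfl : V = W := h
  obtain rfl : P = Q := Set.ext h'
  rfl

lemma hasCarrier_orth (S : ProjectSet α) : S.orth.HasCarrier := fun _ h => h.1

lemma HasCarrier.le_orth_orth {S : ProjectSet α} (h : S.HasCarrier) :
    ∀ a ∈ S.projects, a ∈ S.orth.orth.projects :=
  fun a ha => ⟨h a ha, fun _ hb => (hb.2 a ha).symm⟩

lemma HasCarrier.orth_orth_orth {S : ProjectSet α} (h : S.HasCarrier) :
    S.orth.orth.orth = S.orth :=
  ext' rfl fun _ => ⟨fun hc => ⟨hc.1, fun a ha => hc.2 a (h.le_orth_orth a ha)⟩,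
    (hasCarrier_orth S).le_orth_orth _⟩

lemma HasCarrier.orth_nonempty {S : ProjectSet α} (h : S.HasCarrier) :
    S.orth.projects.Nonempty := by
  -- Without edges there is no interaction, and the wager `1` keeps the measurement positive and
  -- finite.
  refine ⟨⟨1, WGraph.edgeless S.carrier, fun e => e.elim⟩, rfl, fun a ha => ⟨h a ha, ?_⟩⟩
  rw [sca_edgeless]
  simp

lemma HasCarrier.isConduct_orth {S : ProjectSet α} (h : S.HasCarrier) : S.orth.IsConduct :=
  ⟨h.orth_nonempty, hasCarrier_orth S, h.orth_orth_orth⟩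

lemma IsConduct.hasCarrier {S : ProjectSet α} (h : S.IsConduct) : S.HasCarrier := h.2.1

lemma IsConduct.orth_orth {S : ProjectSet α} (h : S.IsConduct) : S.orth.orth = S := h.2.2

lemma IsConduct.mem_iff {S : ProjectSet α} (h : S.IsConduct) {a : Project α} :
    a ∈ S.projects ↔ a.carrier = S.carrier ∧ ∀ b ∈ S.orth.projects, b.Orthogonal a := by
  conv_lhs => rw [← h.orth_orth]
  rfl

/-- The set of the juxtapositions of projects of two sets. -/
def juxtSet (A B : ProjectSet α) : ProjectSet α :=
  ⟨A.carrier ∪ B.carrier, {p | ∃ a ∈ A.projects, ∃ b ∈ B.projects, p = juxt a b}⟩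

lemma HasCarrier.juxtSet {A B : ProjectSet α} (hA : A.HasCarrier) (hB : B.HasCarrier) :
    (juxtSet A B).HasCarrier := by
  rintro _ ⟨a, ha, b, hb, rfl⟩
  exact congrArg₂ (· ∪ ·) (hA a ha) (hB b hb)

lemma tensor_eq {A B : ProjectSet α} (hA : A.HasCarrier) (hB : B.HasCarrier)
    (h : Disjoint A.carrier B.carrier) : A.tensor B = (juxtSet A B).orth.orth := by
  refine congrArg (fun S : ProjectSet α => S.orth.orth) (ext' rfl fun p => ?_)
  refine exists_congr fun a => and_congr_right fun ha => exists_congr fun b =>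
    and_congr_right fun hb => ?_
  rw [tensor_eq_some (by rwa [hA a ha, hB b hb]), Option.mem_some, eq_comm]

lemma exec_carrier_of_union {f a : Project α} {V W : Finset α} (hf : f.carrier = V ∪ W)
    (ha : a.carrier = V) (h : Disjoint V W) : (exec f a).carrier = W := by
  change symmDiff f.carrier a.carrier = W
  rw [hf, ha]
  ext x
  have : x ∈ V → x ∉ W := fun hx => Finset.disjoint_left.1 h hx
  simp only [Finset.mem_symmDiff, Finset.mem_union]
  tauto

/-- This is the adjunction `sca_juxt_right`. A witness in `T` is needed to see that the cut of `f`
with each `a` is defined, by `sca_le_sca_juxt`. -/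
lemma lolli_orth {A T : ProjectSet α} (hA : A.HasCarrier) (hT : T.HasCarrier)
    (hne : T.projects.Nonempty) (h : Disjoint A.carrier T.carrier) :
    A.lolli T.orth = (juxtSet A T).orth := by
  refine ext' rfl fun f => and_congr_right fun hf => ⟨?_, ?_⟩
  · rintro hp _ ⟨a, ha, t, ht, rfl⟩
    have hd : Disjoint a.carrier t.carrier := by rwa [hA a ha, hT t ht]
    obtain ⟨p, hp, hpT⟩ := hp a ha
    have hfa : sca f a ≠ ⊤ := by
      intro h0
      rw [Project.cut, if_neg (by simpa using h0)] at hp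
      cases hp
    rw [cut_eq_some hfa, Option.mem_some] at hp
    subst hp
    have := (hpT.2 t ht).symm
    refine Orthogonal.symm ⟨?_, ?_⟩
    · rw [hf]
      exact (hA.juxtSet hT _ ⟨a, ha, t, ht, rfl⟩).symm
    · rw [sca_juxt_right hd hfa]
      exact this.2
  · intro hp a ha
    obtain ⟨t, ht⟩ := hne
    have key : sca f a ≠ ⊤ := by
      have hd : Disjoint a.carrier t.carrier := by rwa [hA a ha, hT t ht]
      have := (hp _ ⟨a, ha, t, ht, rfl⟩).symm.2.2
      exact ne_top_of_le_ne_top this (sca_le_sca_juxt f a t hd)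
    have hc : (exec f a).carrier = T.carrier := exec_carrier_of_union hf (hA a ha) h
    refine ⟨exec f a, cut_eq_some key, hc, fun t ht => ?_⟩
    have hd : Disjoint a.carrier t.carrier := by rwa [hA a ha, hT t ht]
    refine Orthogonal.symm ⟨hc.trans (hT t ht).symm, ?_⟩
    rw [← sca_juxt_right hd key]
    exact (hp _ ⟨a, ha, t, ht, rfl⟩).symm.2

lemma par_eq {A B : ProjectSet α} (hB : B.IsConduct) (h : Disjoint A.carrier B.carrier) :
    A.par B = (juxtSet A.orth B.orth).orth := by
  rw [par]
  nth_rw 1 [← hB.orth_orth]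
  exact lolli_orth (hasCarrier_orth A) (hasCarrier_orth B) hB.hasCarrier.orth_nonempty h

lemma orth_deloc (φ : α ↪ β) (S : ProjectSet α) : (S.deloc φ).orth = S.orth.deloc φ := by
  refine ext' rfl fun b => ⟨fun hb => ?_, ?_⟩
  · obtain ⟨b, hbV, rfl⟩ := exists_deloc_eq φ hb.1
    refine ⟨b, ⟨hbV, fun a ha => ?_⟩, rfl⟩
    obtain ⟨h1, h2⟩ := hb.2 _ ⟨a, ha, rfl⟩
    rw [sca_deloc] at h2
    exact ⟨Finset.map_injective φ h1, h2⟩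
  · rintro ⟨b, hb, rfl⟩
    refine ⟨congrArg (Finset.map φ) hb.1, ?_⟩
    rintro _ ⟨a, ha, rfl⟩
    obtain ⟨h1, h2⟩ := hb.2 a ha
    refine ⟨congrArg (Finset.map φ) h1, ?_⟩
    rwa [sca_deloc]

lemma IsConduct.deloc {S : ProjectSet α} (h : S.IsConduct) (φ : α ↪ β) :
    (S.deloc φ).IsConduct := by
  refine ⟨h.1.image _, ?_, ?_⟩
  · rintro _ ⟨a, ha, rfl⟩
    exact congrArg (Finset.map φ) (h.hasCarrier a ha)
  · rw [orth_deloc, orth_deloc, h.orth_orth]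

/-- The set whose only element is the empty project. -/
def unit : ProjectSet α := ⟨∅, {zero}⟩

omit [DecidableEq α] in
lemma hasCarrier_unit : (unit : ProjectSet α).HasCarrier := by
  rintro _ rfl
  rfl

lemma isConduct_one : (one : ProjectSet α).IsConduct :=
  (hasCarrier_orth (unit : ProjectSet α)).isConduct_orth

lemma bot_eq : (bot : ProjectSet α) = unit.orth := hasCarrier_unit.orth_orth_orth

lemma isConduct_bot : (bot : ProjectSet α).IsConduct := isConduct_one.hasCarrier.isConduct_orth

end ProjectSet

end GoI

namespace GoI

open Project ProjectSet

/-! ### Well-located formulas and sequents -/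

/-- In every subformula `A ⊗ B` or `A ⅋ B` the locations of `A` and `B` are disjoint. -/
def Formula.WellLocated (n : ℕ → ℕ) : Formula (ℕ × ℕ) → Prop
  | .tensor A B => A.WellLocated n ∧ B.WellLocated n ∧ Disjoint (A.location n) (B.location n)
  | .par A B => A.WellLocated n ∧ B.WellLocated n ∧ Disjoint (A.location n) (B.location n)
  | _ => True

/-- The formulas of a sequent are well-located and have pairwise disjoint locations. -/
def SeqWellLocated (n : ℕ → ℕ) : List (Formula (ℕ × ℕ)) → Prop
  | [] => True
  | A :: Γ => A.WellLocated n ∧ Disjoint (A.location n) (seqLocation n Γ) ∧ SeqWellLocated n Γ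

section Location

variable {n : ℕ → ℕ}

@[simp] lemma seqLocation_nil : seqLocation n [] = ∅ := rfl

@[simp] lemma seqLocation_cons (A : Formula (ℕ × ℕ)) (Γ : List (Formula (ℕ × ℕ))) :
    seqLocation n (A :: Γ) = A.location n ∪ seqLocation n Γ := rfl

@[simp] lemma seqLocation_append (Γ Δ : List (Formula (ℕ × ℕ))) :
    seqLocation n (Γ ++ Δ) = seqLocation n Γ ∪ seqLocation n Δ := by
  induction Γ with
  | nil => simp
  | cons A Γ ih => simp [ih, Finset.union_assoc]

lemma seqWellLocated_append (Γ Δ : List (Formula (ℕ × ℕ))) :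
    SeqWellLocated n (Γ ++ Δ) ↔ SeqWellLocated n Γ ∧ SeqWellLocated n Δ ∧
      Disjoint (seqLocation n Γ) (seqLocation n Δ) := by
  induction Γ with
  | nil => simp [SeqWellLocated]
  | cons A Γ ih =>
    simp only [List.cons_append, SeqWellLocated, ih, seqLocation_append, seqLocation_cons,
      Finset.disjoint_union_right, Finset.disjoint_union_left]
    tauto

lemma Formula.location_dual (A : Formula (ℕ × ℕ)) : A.dual.location n = A.location n := by
  induction A with
  | pos | neg | one | bot => rfl
  | tensor A B hA hB | par A B hA hB => exact congrArg₂ (· ∪ ·) hA hB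

lemma disjoint_varLocation (i : ℕ) {j j' : ℕ} (h : j ≠ j') :
    Disjoint (varLocation n (i, j)) (varLocation n (i, j')) := by
  rw [Finset.disjoint_left]
  intro v hv hv'
  obtain ⟨m, hm, rfl⟩ := Finset.mem_image.1 hv
  obtain ⟨m', hm', h'⟩ := Finset.mem_image.1 hv'
  obtain rfl : m' = m := (Prod.mk.inj h').2
  rw [Finset.mem_Ico] at hm hm'
  have h1 := lt_of_mul_lt_mul_right (hm.1.trans_lt hm'.2) (Nat.zero_le _)
  have h2 := lt_of_mul_lt_mul_right (hm'.1.trans_lt hm.2) (Nat.zero_le _)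
  simp only at h1 h2
  omega

lemma LocProof.seqWellLocated {Γ : List (Formula (ℕ × ℕ))} (ρ : LocProof n Γ) :
    SeqWellLocated n Γ := by
  induction ρ with
  | ax i j j' h =>
    simpa [SeqWellLocated, Formula.WellLocated, Formula.location] using disjoint_varLocation i h
  | cut p q h hp hq => exact (seqWellLocated_append _ _).2 ⟨hp.2.2, hq.2.2, h⟩
  | tensor p q h hp hq =>
    simp only [SeqWellLocated, Formula.WellLocated, Formula.location, seqWellLocated_append,
      seqLocation_append, Finset.disjoint_union_right, Finset.disjoint_union_left] at *
    tauto
  | par p hp =>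
    simp only [SeqWellLocated, Formula.WellLocated, Formula.location, seqLocation_cons,
      Finset.disjoint_union_right, Finset.disjoint_union_left] at *
    tauto
  | one => simp [SeqWellLocated, Formula.WellLocated]
  | bot p hp => simpa [SeqWellLocated, Formula.WellLocated, Formula.location] using hp
  | mix p q h hp hq => exact (seqWellLocated_append _ _).2 ⟨hp, hq, h⟩
  | exchange p hp =>
    simp only [SeqWellLocated, seqWellLocated_append, seqLocation_cons,
      Finset.disjoint_union_right] at *
    have := fun A B : Formula (ℕ × ℕ) =>
      (disjoint_comm (a := A.location n) (b := B.location n)).1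
    tauto

end Location

/-! ### Interpretation of well-located formulas -/

section Formulas

variable {n : ℕ → ℕ} {Φ : ℕ → ProjectSet ℕ}

lemma varLocation_eq_map (x : ℕ × ℕ) :
    varLocation n x = (Finset.range (n x.1)).map (varEmbedding n x) := by
  ext v
  simp only [varLocation, varEmbedding, Finset.mem_image, Finset.mem_Ico, Finset.mem_map,
    Finset.mem_range]
  constructor
  · rintro ⟨m, ⟨h1, h2⟩, rfl⟩
    refine ⟨m - x.2 * n x.1, ?_, ?_⟩
    · rw [add_mul, one_mul] at h2
      omega
    · exact Prod.ext rfl (Nat.add_sub_cancel' h1)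
  · rintro ⟨k, hk, rfl⟩
    refine ⟨_, ⟨Nat.le_add_right _ _, ?_⟩, rfl⟩
    rw [add_mul, one_mul]
    omega

lemma carrier_interpFormula (hΦ : IsBasis n Φ) (A : Formula (ℕ × ℕ)) :
    (interpFormula n Φ A).carrier = A.location n := by
  induction A with
  | pos x | neg x =>
    change (Φ x.1).carrier.map _ = varLocation n x
    rw [(hΦ x.1).2, varLocation_eq_map]
  | one | bot => rfl
  | tensor A B hA hB | par A B hA hB => exact congrArg₂ (· ∪ ·) hA hB

lemma isConduct_interpFormula (hΦ : IsBasis n Φ) {A : Formula (ℕ × ℕ)} (h : A.WellLocated n) :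
    (interpFormula n Φ A).IsConduct := by
  induction A with
  | pos x => exact (hΦ x.1).1.deloc _
  | neg x => exact ((hΦ x.1).1.deloc _).hasCarrier.isConduct_orth
  | one => exact isConduct_one
  | bot => exact isConduct_bot
  | tensor A B hA hB => exact (hasCarrier_orth _).isConduct_orth
  | par A B hA hB =>
    have h1 := hA h.1
    have h2 := hB h.2.1
    change ((interpFormula n Φ A).par (interpFormula n Φ B)).IsConduct
    rw [par_eq h2 (by simpa only [carrier_interpFormula hΦ] using h.2.2)]
    exact ((hasCarrier_orth _).juxtSet (hasCarrier_orth _)).isConduct_orth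

lemma interpFormula_tensor (hΦ : IsBasis n Φ) {A B : Formula (ℕ × ℕ)}
    (h : (Formula.tensor A B).WellLocated n) : interpFormula n Φ (.tensor A B) =
      (juxtSet (interpFormula n Φ A) (interpFormula n Φ B)).orth.orth :=
  tensor_eq (isConduct_interpFormula hΦ h.1).hasCarrier
    (isConduct_interpFormula hΦ h.2.1).hasCarrier
    (by simpa only [carrier_interpFormula hΦ] using h.2.2)

lemma interpFormula_par (hΦ : IsBasis n Φ) {A B : Formula (ℕ × ℕ)}
    (h : (Formula.par A B).WellLocated n) : interpFormula n Φ (.par A B) =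
      (juxtSet (interpFormula n Φ A).orth (interpFormula n Φ B).orth).orth :=
  par_eq (isConduct_interpFormula hΦ h.2.1)
    (by simpa only [carrier_interpFormula hΦ] using h.2.2)

lemma Formula.WellLocated.dual {A : Formula (ℕ × ℕ)} (h : A.WellLocated n) :
    A.dual.WellLocated n := by
  induction A with
  | pos | neg | one | bot => trivial
  | tensor A B hA hB | par A B hA hB =>
    refine ⟨hA h.1, hB h.2.1, ?_⟩
    rw [Formula.location_dual, Formula.location_dual]
    exact h.2.2

/-- A tensor is the biorthogonal of the juxtapositions, and a par is the orthogonal of the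
juxtapositions of the orthogonals; for conducts these two forms are exchanged by orthogonality. -/
lemma interpFormula_dual (hΦ : IsBasis n Φ) {A : Formula (ℕ × ℕ)} (h : A.WellLocated n) :
    interpFormula n Φ A.dual = (interpFormula n Φ A).orth := by
  induction A with
  | pos x => rfl
  | neg x => exact ((hΦ x.1).1.deloc (varEmbedding n x)).orth_orth.symm
  | one => rfl
  | bot => exact isConduct_one.orth_orth.symm
  | tensor A B hA hB =>
    have h1 := isConduct_interpFormula hΦ h.1
    have h2 := isConduct_interpFormula hΦ h.2.1
    rw [interpFormula_tensor hΦ h, (h1.hasCarrier.juxtSet h2.hasCarrier).orth_orth_orth]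
    refine (interpFormula_par hΦ h.dual).trans ?_
    rw [hA h.1, hB h.2.1, h1.orth_orth, h2.orth_orth]
  | par A B hA hB =>
    rw [interpFormula_par hΦ h]
    refine (interpFormula_tensor hΦ h.dual).trans ?_
    rw [hA h.1, hB h.2.1]

end Formulas

/-! ### Tests of a sequent -/

/-- The tests of a sequent: the juxtapositions of projects that are orthogonal to its formulas. -/
def tests (n : ℕ → ℕ) (Φ : ℕ → ProjectSet ℕ) : List (Formula (ℕ × ℕ)) → ProjectSet (ℕ × ℕ)
  | [] => unit
  | A :: Γ => juxtSet (interpFormula n Φ A).orth (tests n Φ Γ)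

section Tests

variable {n : ℕ → ℕ} {Φ : ℕ → ProjectSet ℕ}

lemma carrier_tests (hΦ : IsBasis n Φ) (Γ : List (Formula (ℕ × ℕ))) :
    (tests n Φ Γ).carrier = seqLocation n Γ := by
  induction Γ with
  | nil => rfl
  | cons A Γ ih => exact congrArg₂ (· ∪ ·) (carrier_interpFormula hΦ A) ih

lemma hasCarrier_tests (Γ : List (Formula (ℕ × ℕ))) : (tests n Φ Γ).HasCarrier := by
  induction Γ with
  | nil => exact hasCarrier_unit
  | cons A Γ ih => exact (hasCarrier_orth _).juxtSet ih

lemma carrier_of_mem_tests (hΦ : IsBasis n Φ) {Γ : List (Formula (ℕ × ℕ))}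
    {t : Project (ℕ × ℕ)} (h : t ∈ (tests n Φ Γ).projects) : t.carrier = seqLocation n Γ :=
  (hasCarrier_tests Γ t h).trans (carrier_tests hΦ Γ)

lemma tests_nonempty (hΦ : IsBasis n Φ) {Γ : List (Formula (ℕ × ℕ))} (h : SeqWellLocated n Γ) :
    (tests n Φ Γ).projects.Nonempty := by
  induction Γ with
  | nil => exact ⟨_, rfl⟩
  | cons A Γ ih =>
    obtain ⟨a, ha⟩ := (isConduct_interpFormula hΦ h.1).hasCarrier.orth_nonempty
    obtain ⟨t, ht⟩ := ih h.2.2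
    exact ⟨_, a, ha, t, ht, rfl⟩

/-- Unfolds the iterated par by `lolli_orth`. A single formula is a separate case, where the test
carries an extra empty project. -/
lemma interpSequent_eq (hΦ : IsBasis n Φ) {Γ : List (Formula (ℕ × ℕ))}
    (h : SeqWellLocated n Γ) : interpSequent n Φ Γ = (tests n Φ Γ).orth := by
  induction Γ with
  | nil => exact bot_eq
  | cons A Γ ih =>
    cases Γ with
    | nil =>
      have hA := isConduct_interpFormula hΦ h.1
      refine (show interpSequent n Φ [A] = interpFormula n Φ A from rfl).trans ?_
      rw [← hA.orth_orth]
      refine ProjectSet.ext' (Finset.union_empty _).symm fun b => ?_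
      have hc : (juxtSet (interpFormula n Φ A).orth unit).carrier =
        (interpFormula n Φ A).orth.carrier := Finset.union_empty _
      refine and_congr (iff_of_eq (congrArg (b.carrier = ·) hc.symm)) ⟨?_, ?_⟩
      · rintro hb _ ⟨a, ha, _, rfl, rfl⟩
        exact (juxt_zero_same a).orthogonal_left (hb a ha)
      · intro hb a ha
        exact (juxt_zero_same a).symm.orthogonal_left (hb _ ⟨a, ha, _, rfl, rfl⟩)
    | cons B Γ =>
      change (interpFormula n Φ A).orth.lolli (interpSequent n Φ (B :: Γ)) = _
      rw [ih h.2.2]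
      refine lolli_orth (hasCarrier_orth _) (hasCarrier_tests _) (tests_nonempty hΦ h.2.2) ?_
      rw [carrier_tests hΦ]
      change Disjoint (interpFormula n Φ A).carrier _
      rw [carrier_interpFormula hΦ]
      exact h.2.1

/-- Only up to `Same`, because reassociating juxtapositions changes the type of edges; orthogonality
is insensitive to this. -/
lemma tests_append {Γ Δ : List (Formula (ℕ × ℕ))} {t : Project (ℕ × ℕ)}
    (h : t ∈ (tests n Φ (Γ ++ Δ)).projects) : ∃ g ∈ (tests n Φ Γ).projects,
      ∃ d ∈ (tests n Φ Δ).projects, t.Same (juxt g d) := by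
  induction Γ generalizing t with
  | nil => exact ⟨zero, rfl, t, h, (zero_juxt_same t).symm⟩
  | cons A Γ ih =>
    obtain ⟨a, ha, s, hs, rfl⟩ := h
    obtain ⟨g, hg, d, hd, hgd⟩ := ih hs
    exact ⟨juxt a g, ⟨a, ha, g, hg, rfl⟩, d, hd,
      (juxt_same (.refl a) hgd).trans (juxt_assoc_same a g d).symm⟩

lemma tests_exchange {Γ Δ : List (Formula (ℕ × ℕ))} {A B : Formula (ℕ × ℕ)}
    {t : Project (ℕ × ℕ)} (h : t ∈ (tests n Φ (Γ ++ B :: A :: Δ)).projects) :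
    ∃ t' ∈ (tests n Φ (Γ ++ A :: B :: Δ)).projects, t.Same t' := by
  induction Γ generalizing t with
  | nil =>
    obtain ⟨b, hb, _, ⟨a, ha, d, hd, rfl⟩, rfl⟩ := h
    refine ⟨_, ⟨a, ha, _, ⟨b, hb, d, hd, rfl⟩, rfl⟩, ?_⟩
    exact (juxt_assoc_same b a d).symm.trans ((juxt_same (juxt_comm_same b a) (.refl d)).trans
      (juxt_assoc_same a b d))
  | cons C Γ ih =>
    obtain ⟨c, hc, s, hs, rfl⟩ := h
    obtain ⟨s', hs', hss⟩ := ih hs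
    exact ⟨juxt c s', ⟨c, hc, s', hs', rfl⟩, juxt_same (.refl c) hss⟩

/-- A project of a sequent, cut with a test of the context. -/
lemma exec_mem (hΦ : IsBasis n Φ) {A : Formula (ℕ × ℕ)} {Γ : List (Formula (ℕ × ℕ))}
    (h : SeqWellLocated n (A :: Γ)) {p g : Project (ℕ × ℕ)}
    (hp : p ∈ (tests n Φ (A :: Γ)).orth.projects) (hg : g ∈ (tests n Φ Γ).projects) :
    sca p g ≠ ⊤ ∧ exec p g ∈ (interpFormula n Φ A).projects := by
  have hA := isConduct_interpFormula hΦ h.1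
  have hpc : p.carrier = A.location n ∪ seqLocation n Γ := hp.1.trans (carrier_tests hΦ _)
  have hgc := carrier_of_mem_tests hΦ hg
  have hac : ∀ a ∈ (interpFormula n Φ A).orth.projects, a.carrier = A.location n :=
    fun a ha => ha.1.trans (carrier_interpFormula hΦ A)
  have hdis : ∀ a ∈ (interpFormula n Φ A).orth.projects, Disjoint g.carrier a.carrier :=
    fun a ha => by rw [hac a ha, hgc]; exact h.2.1.symm
  have horth : ∀ a ∈ (interpFormula n Φ A).orth.projects, (juxt g a).Orthogonal p :=
    fun a ha => (juxt_comm_same g a).orthogonal_left (hp.2 _ ⟨a, ha, g, hg, rfl⟩)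
  have hfin : sca p g ≠ ⊤ := by
    obtain ⟨a, ha⟩ := hA.hasCarrier.orth_nonempty
    exact ne_top_of_le_ne_top (horth a ha).symm.2.2 (sca_le_sca_juxt p g a (hdis a ha))
  have hc : (exec p g).carrier = A.location n :=
    exec_carrier_of_union (hpc.trans (Finset.union_comm _ _)) hgc h.2.1.symm
  refine ⟨hfin, hA.mem_iff.2 ⟨hc.trans (carrier_interpFormula hΦ A).symm, fun a ha => ?_⟩⟩
  refine Orthogonal.symm ⟨hc.trans (hac a ha).symm, ?_⟩
  rw [← sca_juxt_right (hdis a ha) hfin]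
  exact (horth a ha).symm.2

end Tests

/-! ### Soundness of the rules -/

section Rules

variable {n : ℕ → ℕ} {Φ : ℕ → ProjectSet ℕ}

/-- Cutting the premises with context tests `d` and `g` gives elements of `A` and of its orthogonal.
Their measurement is that of the cut against `juxt d g`, by `sca_exec_exec`. -/
lemma sound_cut (hΦ : IsBasis n Φ) {A : Formula (ℕ × ℕ)} {Δ Γ : List (Formula (ℕ × ℕ))}
    (h1 : SeqWellLocated n (A :: Δ)) (h2 : SeqWellLocated n (A.dual :: Γ))
    (h : Disjoint (seqLocation n Δ) (seqLocation n Γ)) {p q : Project (ℕ × ℕ)}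
    (hp : p ∈ (tests n Φ (A :: Δ)).orth.projects)
    (hq : q ∈ (tests n Φ (A.dual :: Γ)).orth.projects) :
    sca p q ≠ ⊤ ∧ exec p q ∈ (tests n Φ (Δ ++ Γ)).orth.projects := by
  have hpc : p.carrier = A.location n ∪ seqLocation n Δ := hp.1.trans (carrier_tests hΦ _)
  have hqc : q.carrier = A.location n ∪ seqLocation n Γ := by
    rw [← A.location_dual]
    exact hq.1.trans (carrier_tests hΦ _)
  have hAΔ := h1.2.1
  have hAΓ := h2.2.1
  rw [Formula.location_dual] at hAΓ
  have key : ∀ d ∈ (tests n Φ Δ).projects, ∀ g ∈ (tests n Φ Γ).projects,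
      sca p q ≠ ⊤ ∧ sca (exec p q) (juxt d g) ≠ 0 ∧ sca (exec p q) (juxt d g) ≠ ⊤ := by
    intro d hd g hg
    obtain ⟨hpd, hpd'⟩ := exec_mem hΦ h1 hp hd
    obtain ⟨hqg, hqg'⟩ := exec_mem hΦ h2 hq hg
    rw [interpFormula_dual hΦ h1.1] at hqg'
    have horth := hqg'.2 _ hpd'
    have hdc := carrier_of_mem_tests hΦ hd
    have hgc := carrier_of_mem_tests hΦ hg
    obtain ⟨hpq, heq⟩ := sca_exec_exec (p := p) (q := q) (d := d) (g := g)
      (by rwa [hdc, hgc])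
      (by rw [hpc, hgc]; exact Finset.disjoint_union_left.2 ⟨hAΓ, h⟩)
      (by rw [hqc, hdc]; exact Finset.disjoint_union_left.2 ⟨hAΔ, h.symm⟩) hpd hqg horth.2.2
    rw [heq]
    exact ⟨hpq, horth.2⟩
  obtain ⟨d, hd⟩ := tests_nonempty hΦ h1.2.2
  obtain ⟨g, hg⟩ := tests_nonempty hΦ h2.2.2
  have hc : (exec p q).carrier = seqLocation n Δ ∪ seqLocation n Γ := by
    change symmDiff p.carrier q.carrier = _
    rw [hpc, hqc]
    rw [Finset.disjoint_left] at h hAΔ hAΓ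
    ext v
    have h1 : v ∈ seqLocation n Δ → v ∉ seqLocation n Γ := fun h' => h h'
    have h2 : v ∈ A.location n → v ∉ seqLocation n Δ := fun h' => hAΔ h'
    have h3 : v ∈ A.location n → v ∉ seqLocation n Γ := fun h' => hAΓ h'
    simp only [Finset.mem_symmDiff, Finset.mem_union]
    tauto
  have hc' : (exec p q).carrier = (tests n Φ (Δ ++ Γ)).carrier := by
    rw [hc, carrier_tests hΦ, seqLocation_append]
  refine ⟨(key d hd g hg).1, hc', fun t ht => ?_⟩
  obtain ⟨d, hd, g, hg, htdg⟩ := tests_append ht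
  refine htdg.orthogonal_left (Orthogonal.symm ⟨?_, (key d hd g hg).2⟩)
  rw [hc]
  exact (congrArg₂ (· ∪ ·) (carrier_of_mem_tests hΦ hd) (carrier_of_mem_tests hΦ hg)).symm

/-- The context tests `d` and `g` are absorbed into `p` and `q` by `sca_juxt_juxt_juxt`. What
remains is an element of `A ⊗ B` measured against an element of its orthogonal. -/
lemma sound_tensor (hΦ : IsBasis n Φ) {A B : Formula (ℕ × ℕ)} {Δ Γ : List (Formula (ℕ × ℕ))}
    (h1 : SeqWellLocated n (A :: Δ)) (h2 : SeqWellLocated n (B :: Γ))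
    (h : Disjoint (A.location n ∪ seqLocation n Δ) (B.location n ∪ seqLocation n Γ))
    {p q : Project (ℕ × ℕ)} (hp : p ∈ (tests n Φ (A :: Δ)).orth.projects)
    (hq : q ∈ (tests n Φ (B :: Γ)).orth.projects) :
    Disjoint p.carrier q.carrier ∧
      juxt p q ∈ (tests n Φ (.tensor A B :: (Δ ++ Γ))).orth.projects := by
  have hpc : p.carrier = A.location n ∪ seqLocation n Δ := hp.1.trans (carrier_tests hΦ _)
  have hqc : q.carrier = B.location n ∪ seqLocation n Γ := hq.1.trans (carrier_tests hΦ _)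
  have hAΔ := h1.2.1
  have hBΓ := h2.2.1
  have hpq : Disjoint p.carrier q.carrier := by rwa [hpc, hqc]
  have h' := h
  simp only [Finset.disjoint_union_left, Finset.disjoint_union_right] at h'
  have hAB : (Formula.tensor A B).WellLocated n := ⟨h1.1, h2.1, h'.1.1⟩
  have hjc : (juxt p q).carrier = (A.location n ∪ B.location n) ∪
      (seqLocation n Δ ∪ seqLocation n Γ) := by
    change p.carrier ∪ q.carrier = _
    rw [hpc, hqc, Finset.union_union_union_comm]
  refine ⟨hpq, ?_, ?_⟩
  · rw [hjc, carrier_tests hΦ, seqLocation_cons, seqLocation_append]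
    rfl
  rintro _ ⟨t, ht, s, hs, rfl⟩
  obtain ⟨d, hd, g, hg, hsdg⟩ := tests_append hs
  refine (juxt_same (.refl t) hsdg).orthogonal_left ?_
  obtain ⟨hpd, hpd'⟩ := exec_mem hΦ h1 hp hd
  obtain ⟨hqg, hqg'⟩ := exec_mem hΦ h2 hq hg
  have hdc := carrier_of_mem_tests hΦ hd
  have hgc := carrier_of_mem_tests hΦ hg
  have htc : t.carrier = A.location n ∪ B.location n :=
    ht.1.trans (carrier_interpFormula hΦ (.tensor A B))
  have hmem : juxt (exec p d) (exec q g) ∈ (interpFormula n Φ (.tensor A B)).projects := by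
    rw [interpFormula_tensor hΦ hAB]
    exact ((isConduct_interpFormula hΦ h1.1).hasCarrier.juxtSet
      (isConduct_interpFormula hΦ h2.1).hasCarrier).le_orth_orth _
      ⟨_, hpd', _, hqg', rfl⟩
  refine Orthogonal.symm ⟨?_, ?_⟩
  · rw [hjc, ← htc, ← hdc, ← hgc]
    rfl
  · rw [sca_juxt_juxt_juxt (by rw [hdc, hgc]; exact h'.2.2)
      (by rw [hpc, hgc]; exact Finset.disjoint_union_left.2 ⟨h'.2.1, h'.2.2⟩)
      (by rw [hqc, hdc]; exact Finset.disjoint_union_left.2 ⟨h'.1.2.symm, h'.2.2.symm⟩) hpq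
      (by rw [htc, hdc]; exact Finset.disjoint_union_left.2 ⟨hAΔ, h'.1.2.symm⟩)
      (by rw [htc, hgc]; exact Finset.disjoint_union_left.2 ⟨h'.2.1, hBΓ⟩) hpd hqg]
    exact (ht.2 _ hmem).2

/-- The measurement is a sum of two measurements, and a sum of two numbers in `]0, ∞[` stays there.
-/
lemma sound_mix (hΦ : IsBasis n Φ) {Γ Δ : List (Formula (ℕ × ℕ))}
    (h : Disjoint (seqLocation n Γ) (seqLocation n Δ))
    {p q : Project (ℕ × ℕ)} (hp : p ∈ (tests n Φ Γ).orth.projects)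
    (hq : q ∈ (tests n Φ Δ).orth.projects) :
    Disjoint p.carrier q.carrier ∧ juxt p q ∈ (tests n Φ (Γ ++ Δ)).orth.projects := by
  have hpc : p.carrier = seqLocation n Γ := hp.1.trans (carrier_tests hΦ _)
  have hqc : q.carrier = seqLocation n Δ := hq.1.trans (carrier_tests hΦ _)
  have hjc : (juxt p q).carrier = seqLocation n Γ ∪ seqLocation n Δ :=
    congrArg₂ (· ∪ ·) hpc hqc
  refine ⟨by rwa [hpc, hqc], ?_, fun t ht => ?_⟩
  · rw [hjc, carrier_tests hΦ, seqLocation_append]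
  obtain ⟨g, hg, d, hd, htgd⟩ := tests_append ht
  have hgc := carrier_of_mem_tests hΦ hg
  have hdc := carrier_of_mem_tests hΦ hd
  refine htgd.orthogonal_left (Orthogonal.symm ⟨?_, ?_⟩)
  · rw [hjc, ← hgc, ← hdc]
    rfl
  · rw [sca_juxt_juxt (by rwa [hpc, hdc]) (by rw [hqc, hgc]; exact h.symm)]
    have h1 := (hp.2 g hg).symm.2
    have h2 := (hq.2 d hd).symm.2
    exact ⟨fun h0 => h1.1 (add_eq_zero.1 h0).1, ENNReal.add_ne_top.2 ⟨h1.2, h2.2⟩⟩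

/-- A counter-project of `A ⅋ B` need not be a juxtaposition, so `p` is first cut with the context
test. Membership of the result in `A ⅋ B` is then checked on juxtapositions only. -/
lemma sound_par (hΦ : IsBasis n Φ) {A B : Formula (ℕ × ℕ)} {Γ : List (Formula (ℕ × ℕ))}
    (h : SeqWellLocated n (A :: B :: Γ)) {p : Project (ℕ × ℕ)}
    (hp : p ∈ (tests n Φ (A :: B :: Γ)).orth.projects) :
    p ∈ (tests n Φ (.par A B :: Γ)).orth.projects := by
  have hpc : p.carrier = A.location n ∪ (B.location n ∪ seqLocation n Γ) :=
    hp.1.trans (carrier_tests hΦ _)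
  have h1 := h.2.1
  rw [seqLocation_cons, Finset.disjoint_union_right] at h1
  have hAB : (Formula.par A B).WellLocated n := ⟨h.1, h.2.2.1, h1.1⟩
  have hdis : Disjoint (A.location n ∪ B.location n) (seqLocation n Γ) :=
    Finset.disjoint_union_left.2 ⟨h1.2, h.2.2.2.1⟩
  refine ⟨?_, ?_⟩
  · rw [hpc, carrier_tests hΦ, ← Finset.union_assoc]
    rfl
  rintro _ ⟨t, ht, g, hg, rfl⟩
  have hgc := carrier_of_mem_tests hΦ hg
  have htc : t.carrier = A.location n ∪ B.location n :=
    ht.1.trans (carrier_interpFormula hΦ (.par A B))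
  have hpc' : p.carrier = seqLocation n Γ ∪ (A.location n ∪ B.location n) := by
    rw [hpc, ← Finset.union_assoc, Finset.union_comm]
  have hec : (exec p g).carrier = A.location n ∪ B.location n :=
    exec_carrier_of_union hpc' hgc hdis.symm
  have horth : ∀ a ∈ (interpFormula n Φ A).orth.projects,
      ∀ b ∈ (interpFormula n Φ B).orth.projects, (juxt g (juxt a b)).Orthogonal p := by
    intro a ha b hb
    refine Same.orthogonal_left ?_ (hp.2 _ ⟨a, ha, _, ⟨b, hb, g, hg, rfl⟩, rfl⟩)
    exact (juxt_comm_same _ _).trans (juxt_assoc_same _ _ _)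
  have hdab : ∀ a ∈ (interpFormula n Φ A).orth.projects,
      ∀ b ∈ (interpFormula n Φ B).orth.projects, Disjoint g.carrier (juxt a b).carrier := by
    intro a ha b hb
    have : (juxt a b).carrier = A.location n ∪ B.location n := congrArg₂ (· ∪ ·)
      (ha.1.trans (carrier_interpFormula hΦ A)) (hb.1.trans (carrier_interpFormula hΦ B))
    rw [this, hgc]
    exact hdis.symm
  obtain ⟨a, ha⟩ := (isConduct_interpFormula hΦ h.1).hasCarrier.orth_nonempty
  obtain ⟨b, hb⟩ := (isConduct_interpFormula hΦ h.2.2.1).hasCarrier.orth_nonempty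
  have hfin : sca p g ≠ ⊤ := ne_top_of_le_ne_top (horth a ha b hb).symm.2.2
    (sca_le_sca_juxt p g _ (hdab a ha b hb))
  have hmem : exec p g ∈ (interpFormula n Φ (.par A B)).projects := by
    rw [interpFormula_par hΦ hAB]
    refine ⟨hec.trans (congrArg₂ (· ∪ ·) (carrier_interpFormula hΦ A)
      (carrier_interpFormula hΦ B)).symm, ?_⟩
    rintro _ ⟨a, ha, b, hb, rfl⟩
    refine Orthogonal.symm ⟨?_, ?_⟩
    · rw [hec]
      exact (congrArg₂ (· ∪ ·) (ha.1.trans (carrier_interpFormula hΦ A))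
        (hb.1.trans (carrier_interpFormula hΦ B))).symm
    · rw [← sca_juxt_right (hdab a ha b hb) hfin]
      exact (horth a ha b hb).symm.2
  refine (juxt_comm_same t g).orthogonal_left (Orthogonal.symm ⟨?_, ?_⟩)
  · rw [hpc', ← hgc, ← htc]
    rfl
  · rw [sca_juxt_right (by rw [hgc, htc]; exact hdis.symm) hfin]
    exact (ht.2 _ hmem).2

lemma sound_one : zero ∈ (tests n Φ [.one]).orth.projects := by
  refine ⟨rfl, ?_⟩
  rintro _ ⟨t, ht, _, rfl, rfl⟩
  exact (juxt_zero_same t).orthogonal_left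
    (ht.2 zero (hasCarrier_unit.le_orth_orth _ rfl)).symm

/-- A counter-project of `⊥` has empty carrier, so it only adds its finite wager to the measurement.
-/
lemma sound_bot {Γ : List (Formula (ℕ × ℕ))} {p : Project (ℕ × ℕ)}
    (hp : p ∈ (tests n Φ Γ).orth.projects) : p ∈ (tests n Φ (.bot :: Γ)).orth.projects := by
  refine ⟨hp.1.trans (Finset.empty_union _).symm, ?_⟩
  rintro _ ⟨t, ht, g, hg, rfl⟩
  have htc : t.carrier = ∅ := ht.1
  have hpg := hp.2 g hg
  refine ⟨?_, ?_⟩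
  · rw [← hpg.1]
    change t.carrier ∪ g.carrier = g.carrier
    rw [htc, Finset.empty_union]
  · have : sca (juxt t g) p = t.wager + sca g p := by
      rw [sca, sca, juxt]
      simp only [ENNReal.coe_add]
      rw [(WGraph.union_same_of_eq_empty htc g.graph).interaction_left]
      ring
    rw [this]
    exact ⟨fun h0 => hpg.2.1 (add_eq_zero.1 h0).2,
      ENNReal.add_ne_top.2 ⟨ENNReal.coe_ne_top, hpg.2.2⟩⟩

lemma sound_exchange {Γ Δ : List (Formula (ℕ × ℕ))} {A B : Formula (ℕ × ℕ)}
    {p : Project (ℕ × ℕ)} (hp : p ∈ (tests n Φ (Γ ++ A :: B :: Δ)).orth.projects)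
    (hΦ : IsBasis n Φ) : p ∈ (tests n Φ (Γ ++ B :: A :: Δ)).orth.projects := by
  refine ⟨?_, fun t ht => ?_⟩
  · rw [hp.1, carrier_tests hΦ, carrier_tests hΦ]
    simp only [seqLocation_append, seqLocation_cons]
    rw [Finset.union_left_comm (A.location n)]
  · obtain ⟨t', ht', h⟩ := tests_exchange ht
    exact h.orthogonal_left (hp.2 t' ht')

end Rules

end GoI

namespace GoI

/-! ### The axiom rule -/

namespace WGraph

variable {α β : Type} [DecidableEq α]

/-- A link on a circuit would have both ends in `V`, whereas each link has exactly one; and edges of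
`A` alone do not alternate. -/
lemma interaction_axiomLinks_self (V : Finset α) (φ : α → α) (hd : Disjoint V (V.image φ))
    (A : WGraph α) (hA : A.V = V) : interaction (axiomLinks V φ) A = 0 := by
  rw [interaction_eq_plugSum, plugSum,
    ← circSum_embed (R := A.noRel) (w := A.w) (Sum.inr : A.E → (axiomLinks V φ).E ⊕ A.E)
      Sum.inr_injective (fun _ _ => Iff.rfl) (fun _ => rfl) ?_]
  · exact circSum_eq_zero fun _ _ _ h _ => h
  · rintro (e | e) (a | a) (b | b) h h' <;> simp only [plugRel, noRel] at h h'
    · have h1 : e.1.1 ∈ V := hA.le (by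
        rw [← show A.tgt a = e.1.1 from h]
        exact A.tgt_mem a)
      have h2 : e.1.2 ∈ V := hA.le (by
        rw [show e.1.2 = A.src b from h']
        exact A.src_mem b)
      rw [Finset.disjoint_left] at hd
      rcases e.2 with h3 | h3
      · exact (hd h2 (h3.2 ▸ Finset.mem_image_of_mem φ h3.1)).elim
      · exact (hd h1 (h3.2 ▸ Finset.mem_image_of_mem φ h3.1)).elim
    · exact ⟨e, rfl⟩

/-- Plugging the graph of axiom links into a graph moves this graph to the other location. -/
lemma interaction_axiomLinks (f g : β ↪ α) (φ : α → α) (A : WGraph β) (B : WGraph α)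
    (hφ : ∀ x ∈ A.V, φ (f x) = g x) (hd : Disjoint (A.V.map f) (A.V.map g))
    (hB : B.V = A.V.map g) :
    interaction (axiomLinks (A.V.map f) φ) ((A.deloc f).union B) =
      interaction (A.deloc g) B := by
  have himage : (A.V.map f).image φ = A.V.map g := by
    ext v
    simp only [Finset.mem_image, Finset.mem_map]
    constructor
    · rintro ⟨_, ⟨x, hx, rfl⟩, rfl⟩
      exact ⟨x, hx, (hφ x hx).symm⟩
    · rintro ⟨x, hx, rfl⟩
      exact ⟨_, ⟨x, hx, rfl⟩, hφ x hx⟩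
  set F := axiomLinks (A.V.map f) φ with hF
  have hdf : ∀ x y, x ∈ A.V → y ∈ A.V → f x ≠ g y := fun x y hx hy h =>
    Finset.disjoint_left.1 hd (Finset.mem_map_of_mem f hx) (h ▸ Finset.mem_map_of_mem g hy)
  have hsymm : symmDiff F.V (A.deloc f).V = A.V.map g := by
    have hFV : F.V = A.V.map f ∪ A.V.map g := by rw [← himage]; rfl
    rw [hFV]
    change symmDiff _ (A.V.map f) = _
    ext v
    have : v ∈ A.V.map f → v ∉ A.V.map g := fun h => Finset.disjoint_left.1 hd h
    simp only [Finset.mem_symmDiff, Finset.mem_union]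
    tauto
  let enter : ∀ x ∈ A.V, F.E := fun x hx =>
    ⟨(g x, f x), Or.inr ⟨Finset.mem_map_of_mem f hx, (hφ x hx).symm⟩⟩
  let leave : ∀ x ∈ A.V, F.E := fun x hx =>
    ⟨(f x, g x), Or.inl ⟨Finset.mem_map_of_mem f hx, (hφ x hx).symm⟩⟩
  -- The copy of `a` at the other location: come in by a link, follow `a`, go out by a link.
  let path : A.E → List (F.union (A.deloc f)).E := fun a =>
    [Sum.inl (enter _ (A.src_mem a)), Sum.inr a, Sum.inl (leave _ (A.tgt_mem a))]
  have hpath : ∀ a, IsAltPath F (A.deloc f) (path a) ∧ ∃ h : path a ≠ [],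
      (F.union (A.deloc f)).src ((path a).head h) ∈ symmDiff F.V (A.deloc f).V ∧
      (F.union (A.deloc f)).tgt ((path a).getLast h) ∈ symmDiff F.V (A.deloc f).V := by
    intro a
    rw [hsymm, isAltPath_iff]
    refine ⟨⟨List.cons_ne_nil _ _, ?_⟩, List.cons_ne_nil _ _,
      Finset.mem_map_of_mem g (A.src_mem a), Finset.mem_map_of_mem g (A.tgt_mem a)⟩
    exact List.isChain_cons_cons.2 ⟨⟨rfl, (by decide : (0 : Fin 2) ≠ 1)⟩,
      List.isChain_cons_cons.2 ⟨⟨rfl, (by decide : (1 : Fin 2) ≠ 0)⟩, List.isChain_singleton _⟩⟩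
  have hsrc : ∀ e : F.E, ∀ x ∈ A.V, F.src e = f x → F.tgt e = g x := by
    rintro ⟨⟨u, v⟩, h⟩ x hx rfl
    rcases h with ⟨h, h'⟩ | ⟨h, h'⟩
    · exact h'.trans (hφ x hx)
    · obtain ⟨y, hy, rfl⟩ := Finset.mem_map.1 h
      exact (hdf x y hx hy (h'.trans (hφ y hy))).elim
  have hsrc' : ∀ e : F.E, F.src e ∈ A.V.map g → ∃ x, ∃ hx : x ∈ A.V, e = enter x hx := by
    rintro ⟨⟨u, v⟩, h⟩ hu
    rcases h with ⟨h, h'⟩ | ⟨h, h'⟩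
    · exact (Finset.disjoint_left.1 hd h hu).elim
    · obtain ⟨y, hy, rfl⟩ := Finset.mem_map.1 h
      exact ⟨y, hy, Subtype.ext (Prod.ext (h'.trans (hφ y hy)) rfl)⟩
  have hself : interaction F (A.deloc f) = 0 :=
    interaction_axiomLinks_self _ φ (by rwa [himage]) (A.deloc f) rfl
  rw [interaction_union_right _ _ _ (by rw [hB]; exact hd), hself, zero_add,
    interaction_eq_plugSum, interaction_eq_plugSum]
  symm
  refine circSum_embed (Sum.map (fun a => ⟨path a, hpath a⟩) id) ?_ ?_ ?_ ?_
  · refine Function.Injective.sumMap (fun a b h => ?_) Function.injective_id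
    have : path a = path b := congrArg Subtype.val h
    exact Sum.inr.inj (List.cons.inj (List.cons.inj this).2).1
  · rintro (a | a) (b | b) <;> exact Iff.rfl
  · rintro (a | a)
    · change ((path a).map (F.union (A.deloc f)).w).prod = A.w a
      change 1 * (A.w a * (1 * 1)) = A.w a
      rw [one_mul, mul_one, mul_one]
    · rfl
  · rintro (e | e) - - - -
    swap
    · exact ⟨Sum.inr e, rfl⟩
    -- Conversely, an edge of the reduction starts at the `g` location, so alternation forces a
    -- link, an edge of `A` and a link back to the `g` location. No edge of `A` starts there, so the
    -- path stops.
    suffices ∃ a, path a = e.1 by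
      obtain ⟨a, ha⟩ := this
      exact ⟨Sum.inl a, congrArg Sum.inl (Subtype.ext ha)⟩
    obtain ⟨l, hl, hne, hs, ht⟩ := e
    change ∃ a, path a = l
    rw [isAltPath_iff] at hl
    replace hl := hl.2
    rw [hsymm] at hs ht
    have hAsrc : ∀ a : A.E, f (A.src a) ∉ A.V.map g := fun a h =>
      Finset.disjoint_left.1 hd (Finset.mem_map_of_mem f (A.src_mem a)) h
    rcases l with _ | ⟨e | a, l⟩
    · exact absurd rfl hne
    swap
    · exact (hAsrc a hs).elim
    obtain ⟨x, hx, rfl⟩ := hsrc' e hs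
    rcases l with _ | ⟨e' | a, l⟩
    · exact (Finset.disjoint_left.1 hd (Finset.mem_map_of_mem f hx) ht).elim
    · exact ((List.isChain_cons_cons.1 hl).1.2 rfl).elim
    obtain ⟨⟨h1, -⟩, hl₁⟩ := List.isChain_cons_cons.1 hl
    obtain rfl : x = A.src a := f.injective h1
    rcases l with _ | ⟨e' | b, l⟩
    · exact (Finset.disjoint_left.1 hd (Finset.mem_map_of_mem f (A.tgt_mem a)) ht).elim
    swap
    · exact ((List.isChain_cons_cons.1 hl₁).1.2 rfl).elim
    obtain ⟨⟨h2, -⟩, hl₂⟩ := List.isChain_cons_cons.1 hl₁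
    have h3 : F.tgt e' = g (A.tgt a) := hsrc e' _ (A.tgt_mem a) h2.symm
    rcases l with _ | ⟨e'' | b, l⟩
    · have : e' = leave _ (A.tgt_mem a) := Subtype.ext (Prod.ext h2.symm h3)
      exact ⟨a, by rw [this]⟩
    · exact ((List.isChain_cons_cons.1 hl₂).1.2 rfl).elim
    · have h4 : F.tgt e' = f (A.src b) := (List.isChain_cons_cons.1 hl₂).1.1
      exact (hdf _ _ (A.src_mem b) (A.tgt_mem a) (h4.symm.trans h3)).elim

end WGraph

open Project ProjectSet

lemma varEmbedding_transport (n : ℕ → ℕ) (i j j' x : ℕ) :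
    (fun v : ℕ × ℕ => (v.1, j' * n i + (v.2 - j * n i))) (varEmbedding n (i, j) x) =
      varEmbedding n (i, j') x := by
  change (i, j' * n i + (j * n i + x - j * n i)) = (i, j' * n i + x)
  rw [Nat.add_sub_cancel_left]

lemma image_varLocation (n : ℕ → ℕ) (i j j' : ℕ) : (varLocation n (i, j)).image
    (fun v => (v.1, j' * n i + (v.2 - j * n i))) = varLocation n (i, j') := by
  rw [varLocation_eq_map, varLocation_eq_map, Finset.map_eq_image, Finset.map_eq_image,
    Finset.image_image]
  exact Finset.image_congr fun x _ => varEmbedding_transport n i j j' x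

/-- The links move `a` from copy `j` to copy `j'`, where it meets `b`, a counter-project of the same
conduct `Φ i` at that location. -/
lemma sound_ax {n : ℕ → ℕ} {Φ : ℕ → ProjectSet ℕ} (hΦ : IsBasis n Φ) (i : ℕ) {j j' : ℕ}
    (h : j ≠ j') : fax (varLocation n (i, j)) (fun v => (v.1, j' * n i + (v.2 - j * n i))) ∈
      (tests n Φ [.neg (i, j), .pos (i, j')]).orth.projects := by
  have hφ' := varEmbedding_transport n i j j'
  have himage := image_varLocation n i j j'
  set φ : ℕ × ℕ → ℕ × ℕ := fun v => (v.1, j' * n i + (v.2 - j * n i))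
  have hc : (fax (varLocation n (i, j)) φ).carrier =
      varLocation n (i, j) ∪ varLocation n (i, j') :=
    congrArg (varLocation n (i, j) ∪ ·) himage
  refine ⟨?_, ?_⟩
  · rw [hc, carrier_tests hΦ, seqLocation_cons, seqLocation_cons, seqLocation_nil,
      Finset.union_empty]
    rfl
  rintro _ ⟨a, ha, _, ⟨b, hb, _, rfl, rfl⟩, rfl⟩
  refine (juxt_same (.refl a) (juxt_zero_same b)).orthogonal_left (Orthogonal.symm ?_)
  change a ∈ ((Φ i).deloc (varEmbedding n (i, j))).orth.orth.projects at ha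
  rw [((hΦ i).1.deloc _).orth_orth] at ha
  obtain ⟨a, ha, rfl⟩ := ha
  have hac : a.carrier = Finset.range (n i) := ((hΦ i).1.hasCarrier a ha).trans (hΦ i).2
  have hV : ∀ k, a.graph.V.map (varEmbedding n (i, k)) = varLocation n (i, k) := by
    intro k
    rw [varLocation_eq_map]
    exact congrArg _ hac
  have hbc : b.carrier = varLocation n (i, j') :=
    hb.1.trans (carrier_interpFormula hΦ (.pos (i, j')))
  have horth := hb.2 _ ⟨a, ha, rfl⟩
  have hsca : sca (fax (varLocation n (i, j)) φ) (juxt (Project.deloc (varEmbedding n (i, j)) a) b) =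
      sca (Project.deloc (varEmbedding n (i, j')) a) b := by
    have := WGraph.interaction_axiomLinks (varEmbedding n (i, j)) (varEmbedding n (i, j')) φ
      a.graph b.graph (fun x _ => hφ' x) (by rw [hV, hV]; exact disjoint_varLocation i h)
      (by rw [hV]; exact hbc)
    rw [hV] at this
    simp only [sca, fax, juxt, ENNReal.coe_zero, zero_add, ENNReal.coe_add]
    exact congrArg (_ + ·) this
  refine ⟨?_, ?_⟩
  · rw [hc, ← hV, ← hbc]
    rfl
  · rw [hsca]
    exact horth.2

end GoI

namespace GoI

/-! ### Successful projects -/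

namespace WGraph

variable {α : Type}

/-- A partial matching: all edges have weight `1` and can be reversed, no two edges have the same
source, and there is no loop. -/
structure IsMatching (G : WGraph α) : Prop where
  w_eq_one : ∀ e, G.w e = 1
  src_injective : ∀ e f, G.src e = G.src f → e = f
  exists_reverse : ∀ e, ∃ f, G.src f = G.tgt e ∧ G.tgt f = G.src e
  src_ne_tgt : ∀ e, G.src e ≠ G.tgt e

lemma IsMatching.isSymmetric {G : WGraph α} (h : G.IsMatching) : G.IsSymmetric := by
  intro v _ u _
  have hs : ∀ v u, Subsingleton (G.Edges v u) := fun v u =>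
    ⟨fun e f => Subtype.ext (h.src_injective _ _ (e.2.1.trans f.2.1.symm))⟩
  have hr : ∀ v u, G.Edges v u → Nonempty (G.Edges u v) := fun v u e => by
    obtain ⟨f, h1, h2⟩ := h.exists_reverse e.1
    exact ⟨f, h1.trans e.2.2, h2.trans e.2.1⟩
  have := hs v u
  have := hs u v
  exact ⟨equivOfSubsingletonOfSubsingleton (fun e => (hr v u e).some) fun e => (hr u v e).some,
    fun e => by rw [h.w_eq_one, h.w_eq_one]⟩

/-- A path in a matching can only go back and forth, so a path of length `3` is an edge, its reverse
and the edge again. -/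
lemma IsMatching.pow_three_same {G : WGraph α} (h : G.IsMatching) : (G.pow 3).Same G := by
  choose r hr hr' using h.exists_reverse
  have hrr : ∀ e, r (r e) = e := fun e => h.src_injective _ _ ((hr _).trans (hr' e))
  have key : ∀ l : List G.E, G.IsPath l → l.length = 3 → ∃ e, l = [e, r e, e] := by
    rintro (_ | ⟨a, _ | ⟨b, _ | ⟨c, _ | ⟨d, l⟩⟩⟩⟩) hl h3 <;> simp at h3
    obtain ⟨-, hl⟩ := hl
    simp only [List.isChain_cons_cons, List.isChain_singleton, and_true] at hl
    obtain rfl : r a = b := h.src_injective _ _ ((hr a).trans hl.1)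
    obtain rfl : a = c := h.src_injective _ _ ((hr' a).symm.trans hl.2)
    exact ⟨a, rfl⟩
  have hpath : ∀ e, G.IsPath [e, r e, e] := fun e =>
    ⟨List.cons_ne_nil _ _, by simp [hr, hr']⟩
  refine ⟨rfl, ⟨fun l => l.1.head l.2.1.1, fun e => ⟨[e, r e, e], hpath e, rfl⟩, ?_, ?_⟩, ?_⟩
  · rintro ⟨l, hl, h3⟩
    obtain ⟨e, rfl⟩ := key l hl h3
    rfl
  · intro e
    rfl
  · rintro ⟨l, hl, h3⟩
    obtain ⟨e, rfl⟩ := key l hl h3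
    refine ⟨rfl, rfl, ?_⟩
    simp [pow, pathWeight, h.w_eq_one]

lemma IsMatching.hat {G : WGraph α} (h : G.IsMatching) : G.hat.IsMatching where
  w_eq_one := by
    rintro ⟨p, e, he⟩
    have : Unique (G.Edges p.1 p.2) :=
      ⟨⟨⟨e, he⟩⟩, fun f => Subtype.ext (h.src_injective _ _ (f.2.1.trans he.1.symm))⟩
    change ∑' e : G.Edges p.1 p.2, G.w e.1 = 1
    simp only [h.w_eq_one]
    rw [tsum_fintype]
    simp
  src_injective := by
    rintro ⟨p, e, h1, h2⟩ ⟨q, f, h3, h4⟩ (hpq : p.1 = q.1)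
    obtain rfl := h.src_injective e f (h1.trans (hpq.trans h3.symm))
    exact Subtype.ext (Prod.ext hpq (h2.symm.trans h4))
  exists_reverse := by
    rintro ⟨p, e, h1, h2⟩
    obtain ⟨f, h3, h4⟩ := h.exists_reverse e
    exact ⟨⟨(p.2, p.1), f, h3.trans h2, h4.trans h1⟩, rfl, rfl⟩
  src_ne_tgt := by
    rintro ⟨p, e, h1, h2⟩ h3
    exact h.src_ne_tgt e (h1.trans (Eq.trans h3 h2.symm))

lemma IsMatching.trace_eq_zero {G : WGraph α} (h : G.IsMatching) : G.trace = 0 := by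
  refine Finset.sum_eq_zero fun v _ => ?_
  have : IsEmpty (G.Edges v v) := ⟨fun e => h.src_ne_tgt e.1 (e.2.1.trans e.2.2.symm)⟩
  exact tsum_empty

lemma isMatching_edgeless (V : Finset α) : (edgeless V).IsMatching :=
  ⟨fun e => e.elim, fun e => e.elim, fun e => e.elim, fun e => e.elim⟩

variable [DecidableEq α]

lemma IsMatching.union {G H : WGraph α} (hG : G.IsMatching) (hH : H.IsMatching)
    (h : Disjoint G.V H.V) : (G.union H).IsMatching where
  w_eq_one := by
    rintro (e | e)
    · exact hG.w_eq_one e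
    · exact hH.w_eq_one e
  src_injective := by
    rw [Finset.disjoint_left] at h
    rintro (e | e) (f | f) hef
    · exact congrArg Sum.inl (hG.src_injective e f hef)
    · exact (h (G.src_mem e) ((show G.src e = H.src f from hef) ▸ H.src_mem f)).elim
    · exact (h (G.src_mem f) ((show H.src e = G.src f from hef) ▸ H.src_mem e)).elim
    · exact congrArg Sum.inr (hH.src_injective e f hef)
  exists_reverse := by
    rintro (e | e)
    · obtain ⟨f, hf⟩ := hG.exists_reverse e
      exact ⟨Sum.inl f, hf⟩
    · obtain ⟨f, hf⟩ := hH.exists_reverse e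
      exact ⟨Sum.inr f, hf⟩
  src_ne_tgt := by
    rintro (e | e)
    · exact hG.src_ne_tgt e
    · exact hH.src_ne_tgt e

lemma isMatching_axiomLinks {V : Finset α} {φ : α → α} (hφ : Set.InjOn φ V)
    (hd : Disjoint V (V.image φ)) : (axiomLinks V φ).IsMatching where
  w_eq_one _ := rfl
  src_injective := by
    rw [Finset.disjoint_left] at hd
    rintro ⟨⟨a, b⟩, ⟨h1, h2⟩ | ⟨h1, h2⟩⟩ ⟨⟨c, d⟩, ⟨h3, h4⟩ | ⟨h3, h4⟩⟩ (h : a = c)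
    all_goals
      refine Subtype.ext (Prod.ext h ?_)
      simp only at h1 h2 h3 h4 ⊢
      subst h
    · exact h2.trans h4.symm
    · exact (hd h1 (h4 ▸ Finset.mem_image_of_mem φ h3)).elim
    · exact (hd h3 (h2 ▸ Finset.mem_image_of_mem φ h1)).elim
    · exact hφ h1 h3 (h2.symm.trans h4)
  exists_reverse := by
    rintro ⟨⟨a, b⟩, h⟩
    exact ⟨⟨(b, a), h.symm⟩, rfl, rfl⟩
  src_ne_tgt := by
    rw [Finset.disjoint_left] at hd
    rintro ⟨⟨a, b⟩, ⟨h1, h2⟩ | ⟨h1, h2⟩⟩ (h : a = b) <;> simp only at h1 h2 <;> subst h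
    · exact hd h1 (h2 ▸ Finset.mem_image_of_mem φ h1)
    · exact hd h1 (h2 ▸ Finset.mem_image_of_mem φ h1)

lemma eq_of_src_eq_of_color_eq {G H : WGraph α} (hG : G.IsMatching) (hH : H.IsMatching)
    {e f : (G.union H).E} (h : (G.union H).src e = (G.union H).src f)
    (hc : color G H e = color G H f) : e = f := by
  rcases e with e | e <;> rcases f with f | f
  · exact congrArg Sum.inl (hG.src_injective e f h)
  · simp [color] at hc
  · simp [color] at hc
  · exact congrArg Sum.inr (hH.src_injective e f h)

/-- The junction of two edges of different colours is a vertex of both graphs. So an alternating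
path that has reached the symmetric difference cannot be continued. -/
lemma mem_of_color_ne {G H : WGraph α} {e f : (G.union H).E} (h : altRel G H e f) :
    (G.union H).tgt e ∉ symmDiff G.V H.V := by
  obtain ⟨h1, h2⟩ := h
  rw [Finset.mem_symmDiff]
  rcases e with e | e <;> rcases f with f | f
  · exact (h2 rfl).elim
  · have h3 : (G.union H).tgt (Sum.inl e) ∈ G.V := G.tgt_mem e
    have h4 : (G.union H).tgt (Sum.inl e) ∈ H.V := h1 ▸ H.src_mem f
    tauto
  · have h3 : (G.union H).tgt (Sum.inr e) ∈ H.V := H.tgt_mem e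
    have h4 : (G.union H).tgt (Sum.inr e) ∈ G.V := h1 ▸ G.src_mem f
    tauto
  · exact (h2 rfl).elim

lemma color_eq_of_mem_symmDiff {G H : WGraph α} {e f : (G.union H).E}
    (h : (G.union H).src e = (G.union H).src f)
    (he : (G.union H).src e ∈ symmDiff G.V H.V) : color G H e = color G H f := by
  rw [Finset.mem_symmDiff] at he
  rcases e with e | e <;> rcases f with f | f
  · rfl
  · have h3 : (G.union H).src (Sum.inl e) ∈ G.V := G.src_mem e
    have h4 : (G.union H).src (Sum.inl e) ∈ H.V := h ▸ H.src_mem f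
    tauto
  · have h3 : (G.union H).src (Sum.inr e) ∈ H.V := H.src_mem e
    have h4 : (G.union H).src (Sum.inr e) ∈ G.V := h ▸ G.src_mem f
    tauto
  · rfl

/-- An alternating path between matchings that ends in the symmetric difference is determined by
its source and its first colour. -/
lemma altPath_unique {G H : WGraph α} (hG : G.IsMatching) (hH : H.IsMatching)
    (l l' : List (G.union H).E) (a b : (G.union H).E)
    (hl : (a :: l).IsChain (altRel G H)) (hl' : (b :: l').IsChain (altRel G H))
    (hab : (G.union H).src a = (G.union H).src b) (hc : color G H a = color G H b)
    (ht : (G.union H).tgt ((a :: l).getLast (List.cons_ne_nil _ _)) ∈ symmDiff G.V H.V)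
    (ht' : (G.union H).tgt ((b :: l').getLast (List.cons_ne_nil _ _)) ∈ symmDiff G.V H.V) :
    a :: l = b :: l' := by
  induction l generalizing a b l' with
  | nil =>
    obtain rfl := eq_of_src_eq_of_color_eq hG hH hab hc
    cases l' with
    | nil => rfl
    | cons d l' => exact (mem_of_color_ne (List.isChain_cons_cons.1 hl').1 ht).elim
  | cons c l ih =>
    obtain rfl := eq_of_src_eq_of_color_eq hG hH hab hc
    obtain ⟨h1, hl⟩ := List.isChain_cons_cons.1 hl
    cases l' with
    | nil => exact (mem_of_color_ne h1 ht').elim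
    | cons d l' =>
      obtain ⟨h2, hl'⟩ := List.isChain_cons_cons.1 hl'
      rw [List.getLast_cons_cons] at ht ht'
      have hcd : color G H c = color G H d := by
        have h3 := h1.2
        have h4 := h2.2
        omega
      rw [ih l' c d hl hl' (h1.1.symm.trans h2.1) hcd ht ht']

/-- A path of the reduction is determined by its source (`altPath_unique`), and reversing each of
its edges gives the opposite path. A loop would thus equal its own reversal, which the middle of the
path contradicts. -/
lemma IsMatching.reduction {G H : WGraph α} (hG : G.IsMatching) (hH : H.IsMatching) :
    (G.reduction H).IsMatching := by
  have hunique : ∀ l l' : (G.reduction H).E,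
      (G.reduction H).src l = (G.reduction H).src l' → l = l' := by
    rintro ⟨l, hl, hne, hs, ht⟩ ⟨l', hl', hne', hs', ht'⟩ h
    refine Subtype.ext ?_
    change l = l'
    cases l with
    | nil => exact absurd rfl hne
    | cons a l =>
      cases l' with
      | nil => exact absurd rfl hne'
      | cons b l' =>
        exact altPath_unique hG hH l l' a b ((isAltPath_iff _ _ _).1 hl).2
          ((isAltPath_iff _ _ _).1 hl').2 h (color_eq_of_mem_symmDiff h hs) ht ht'
  have hrev : ∀ e : (G.union H).E, ∃ f, (G.union H).src f = (G.union H).tgt e ∧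
      (G.union H).tgt f = (G.union H).src e ∧ color G H f = color G H e := by
    rintro (e | e)
    · obtain ⟨f, h1, h2⟩ := hG.exists_reverse e
      exact ⟨Sum.inl f, h1, h2, rfl⟩
    · obtain ⟨f, h1, h2⟩ := hH.exists_reverse e
      exact ⟨Sum.inr f, h1, h2, rfl⟩
  choose r hr hr' hrc using hrev
  have hrevPath : ∀ l : (G.reduction H).E, ∃ l' : (G.reduction H).E,
      l'.1 = (l.1.map r).reverse ∧ (G.reduction H).src l' = (G.reduction H).tgt l ∧
        (G.reduction H).tgt l' = (G.reduction H).src l := by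
    rintro ⟨l, hl, hne, hs, ht⟩
    have hne' : (l.map r).reverse ≠ [] := by simpa using hne
    have h1 : (G.union H).src ((l.map r).reverse.head hne') =
        (G.union H).tgt (l.getLast hne) := by
      rw [List.head_reverse, List.getLast_map, hr]
    have h2 : (G.union H).tgt ((l.map r).reverse.getLast hne') =
        (G.union H).src (l.head hne) := by
      rw [List.getLast_reverse, List.head_map, hr']
    refine ⟨⟨(l.map r).reverse, ?_, hne', ?_, ?_⟩, rfl, h1, h2⟩
    · rw [isAltPath_iff] at hl ⊢
      refine ⟨hne', ?_⟩
      rw [List.isChain_reverse, List.isChain_map]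
      refine hl.2.imp fun a b hab => ⟨?_, ?_⟩
      · rw [hr, hr']
        exact hab.1.symm
      · rw [hrc, hrc]
        exact hab.2.symm
    · rwa [h1]
    · rwa [h2]
  refine ⟨fun l => ?_, hunique, fun l => ?_, fun l hloop => ?_⟩
  · refine List.prod_eq_one fun x hx => ?_
    obtain ⟨e | e, -, rfl⟩ := List.mem_map.1 hx
    · exact hG.w_eq_one e
    · exact hH.w_eq_one e
  · obtain ⟨l', -, h1, h2⟩ := hrevPath l
    exact ⟨l', h1, h2⟩
  · obtain ⟨l', h0, h1, -⟩ := hrevPath l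
    rw [hunique l' l (h1.trans hloop.symm)] at h0
    clear h1 hloop
    have hl := l.2.1
    generalize l.1 = l at h0 hl
    rw [isAltPath_iff] at hl
    have hne := hl.1
    have hpos : 0 < l.length := List.length_pos_of_ne_nil hne
    have hget : ∀ i (hi : i < l.length), l[i] = r (l[l.length - 1 - i]) := by
      intro i hi
      have : l[i]? = (l.map r).reverse[i]? := by rw [← h0]
      rw [List.getElem?_eq_getElem hi, List.getElem?_eq_getElem (by simpa using hi)] at this
      simpa [List.getElem_reverse] using Option.some.inj this
    rcases Nat.even_or_odd' l.length with ⟨k, hk | hk⟩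
    -- Even length: the two middle edges are reverses of each other, so they have the same colour,
    -- against alternation.
    · have h3 := hget (k - 1) (by omega)
      have h4 := List.isChain_iff_getElem.1 hl.2 (k - 1) (by omega)
      have h5 : l.length - 1 - (k - 1) = k - 1 + 1 := by omega
      simp only [h5] at h3
      refine h4.2 ?_
      rw [h3, hrc]
    -- Odd length: the middle edge is its own reverse, hence a loop of `G` or `H`.
    · have h3 := hget k (by omega)
      have h5 : l.length - 1 - k = k := by omega
      simp only [h5] at h3
      have h6 : (G.union H).src l[k] = (G.union H).tgt l[k] := by
        conv_lhs => rw [h3]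
        rw [hr]
      generalize l[k]'(by omega) = e at h6
      rcases e with e | e
      · exact hG.src_ne_tgt e h6
      · exact hH.src_ne_tgt e h6

/-- The interaction of two matchings is `0` or `∞`. -/
lemma IsMatching.interaction_eq_zero {G H : WGraph α} (hG : G.IsMatching) (hH : H.IsMatching)
    (h : interaction G H ≠ ⊤) : interaction G H = 0 := by
  refine ENNReal.tsum_eq_zero.2 fun c => (h ?_).elim
  have hw : circuitWeight G H c = 1 := by
    refine Multiset.prod_eq_one fun x hx => ?_
    obtain ⟨e | e, -, rfl⟩ := Multiset.mem_map.1 hx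
    · exact hG.w_eq_one e
    · exact hH.w_eq_one e
  refine top_unique ?_
  calc ⊤ = colog (circuitWeight G H c) := by rw [hw, colog, if_neg (lt_irrefl _)]
    _ ≤ interaction G H := ENNReal.le_tsum c

end WGraph

open Project ProjectSet

lemma Project.isSuccessful_of_isMatching {α : Type} {a : Project α} (h : a.wager = 0)
    (h' : a.graph.IsMatching) : a.IsSuccessful :=
  ⟨h, h'.hat.isSymmetric, h'.hat.pow_three_same, h'.trace_eq_zero⟩

lemma isMatching_fax {n : ℕ → ℕ} (i : ℕ) {j j' : ℕ} (h : j ≠ j') :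
    (fax (varLocation n (i, j)) (fun v => (v.1, j' * n i + (v.2 - j * n i)))).graph.IsMatching := by
  refine WGraph.isMatching_axiomLinks ?_ ?_
  · intro u hu v hv huv
    obtain ⟨m, hm, rfl⟩ := Finset.mem_image.1 hu
    obtain ⟨m', hm', rfl⟩ := Finset.mem_image.1 hv
    rw [Finset.mem_Ico] at hm hm'
    simp only [Prod.mk.injEq, true_and] at huv hm hm' ⊢
    omega
  · rw [image_varLocation]
    exact disjoint_varLocation i h

/-- The interpretation of a localized derivation is defined, belongs to the interpretation of its
conclusion, and is a partial matching with wager `0`. -/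
lemma LocProof.sound {n : ℕ → ℕ} {Φ : ℕ → ProjectSet ℕ} (hΦ : IsBasis n Φ)
    {Γ : List (Formula (ℕ × ℕ))} (ρ : LocProof n Γ) : ∃ p, interpProof ρ = some p ∧
      p ∈ (tests n Φ Γ).orth.projects ∧ p.wager = 0 ∧ p.graph.IsMatching := by
  induction ρ with
  | ax i j j' h => exact ⟨_, rfl, sound_ax hΦ i h, rfl, isMatching_fax i h⟩
  | cut p q h hp hq =>
    obtain ⟨a, ha, ha', ha0, hma⟩ := hp
    obtain ⟨b, hb, hb', hb0, hmb⟩ := hq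
    obtain ⟨hfin, hmem⟩ := sound_cut hΦ p.seqWellLocated q.seqWellLocated h ha' hb'
    refine ⟨exec a b, ?_, hmem, ?_, hma.reduction hmb⟩
    · simp only [interpProof, ha, hb, Option.bind_some, cut_eq_some hfin]
    -- The interaction is finite by `sound_cut`, hence `0` since both graphs are matchings; the cut
    -- adds nothing to the wager.
    · rw [sca, ha0, hb0] at hfin
      simp only [ENNReal.coe_zero, zero_add] at hfin
      simp [exec, sca, ha0, hb0, hma.interaction_eq_zero hmb hfin]
  | tensor p q h hp hq =>
    obtain ⟨a, ha, ha', ha0, hma⟩ := hp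
    obtain ⟨b, hb, hb', hb0, hmb⟩ := hq
    obtain ⟨hdis, hmem⟩ := sound_tensor hΦ p.seqWellLocated q.seqWellLocated h ha' hb'
    refine ⟨juxt a b, ?_, hmem, ?_, hma.union hmb hdis⟩
    · simp only [interpProof, ha, hb, Option.bind_some, tensor_eq_some hdis]
    · simp [juxt, ha0, hb0]
  | par p hp =>
    obtain ⟨a, ha, ha', h⟩ := hp
    exact ⟨a, ha, sound_par hΦ p.seqWellLocated ha', h⟩
  | one => exact ⟨zero, rfl, sound_one, rfl, WGraph.isMatching_edgeless _⟩
  | bot p hp =>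
    obtain ⟨a, ha, ha', h⟩ := hp
    exact ⟨a, ha, sound_bot ha', h⟩
  | mix p q h hp hq =>
    obtain ⟨a, ha, ha', ha0, hma⟩ := hp
    obtain ⟨b, hb, hb', hb0, hmb⟩ := hq
    obtain ⟨hdis, hmem⟩ := sound_mix hΦ h ha' hb'
    refine ⟨juxt a b, ?_, hmem, ?_, hma.union hmb hdis⟩
    · simp only [interpProof, ha, hb, Option.bind_some, tensor_eq_some hdis]
    · simp [juxt, ha0, hb0]
  | exchange p hp =>
    obtain ⟨a, ha, ha', h⟩ := hp
    exact ⟨a, ha, sound_exchange ha' hΦ, h⟩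

end GoI
end

theorem mainTheorem8
    -- sizes of the variable names and basis of interpretation
    (n : ℕ → ℕ) (Φ : ℕ → GoI.ProjectSet ℕ) (hΦ : GoI.IsBasis n Φ)
    -- a proof `π` of MLL+MIX of conclusion `⊢ Γ`, and an enumeration `e`
    (Γ : List (GoI.Formula ℕ)) (π : GoI.MLLProof Γ) (e : GoI.Occ π → ℕ)
    -- the localized sequent `⊢ Γ ^ e` and the locMLL proof `π ^ e`
    (Γe : List (GoI.Formula (ℕ × ℕ))) (πe : GoI.LocProof n Γe)
    (hπe : GoI.Localizes n π e πe) (hlin : πe.IsLinear) :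
    (GoI.interpSequent n Φ Γe).IsConduct ∧
      ∃ p ∈ GoI.interpProof πe, p.IsSuccessful ∧ p ∈ (GoI.interpSequent n Φ Γe).projects := by
  rw [GoI.interpSequent_eq hΦ πe.seqWellLocated]
  obtain ⟨p, hp, hmem, h0, hmatch⟩ := πe.sound hΦ
  exact ⟨(GoI.hasCarrier_tests Γe).isConduct_orth, p, hp,
    GoI.Project.isSuccessful_of_isMatching h0 hmatch, hmem⟩
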